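/- Let $k$ be an infinite field (for example an algebraically closed field), let $t \ge 1$, and let $d = (d_1,\dots,d_t)$ be a dimension vector with $d_i > 0$ for all $i$. Let $$\mathcal R(Q,d)=\bigoplus_{i=1}^{t-1}\operatorname{Hom}(k^{d_{i+1}},k^{d_i})$$ be the space of representations $A=(A_{1,2},\dots,A_{t-1,t})$, $A_{i,i+1}\colon k^{d_{i+1}}\to k^{d_i}$, of the equioriented quiver of type $\mathbb A_t$. It carries the Zariski topology (closed sets are the common zero sets in $\mathcal R(Q,d)$ of polynomials over $k$ in the matrix entries) and the action of $\mathrm{GL}(d)=\prod_{i=1}^t \mathrm{GL}_{d_i}(k)$ by change of bases. The codimension of a closed subset is the height of its vanishing ideal in the polynomial ring over $k$ in the matrix entries. The irreducible components of a subset are its maximal irreducible subsets. For $i<j$ put $$A_{(i,j)}=A_{i,i+1}A_{i+1,i+2}\cdots A_{j-1,j},\qquad r_{i,j}=\min\{d_l \mid i\le l\le j\},$$ $$\mathcal O(d)=\{A \mid \operatorname{rk}A_{(i,j)}=r_{i,j}\text{ for all } i<j\},\qquad Y=\mathcal R(Q,d)\setminus\mathcal O(d),\qquad Y_{i,j}=\{A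 \mid \operatorname{rk}A_{(i,j)}\le r_{i,j}-1\}.$$ Let $J(d)$ be the set of pairs $(i,j)$ with $1\le i<j\le t$ and $d_l>\max\{d_i,d_j\}$ for all $i<l<j$. With $d_0=d_{t+1}=0$, let $I(d)$ be the set of all $(i,j)\in J(d)$ such that one of the following holds: - $d_i=d_j$; - $d_i<d_j$ and, for the minimal index $a>j$ with $d_a<d_i$, one has $d_l\ge d_j$ for all $j<l<a$; - $d_i>d_j$ and, for the maximal index $b<i$ with $d_b<d_j$, one has $d_l\ge d_i$ for all $b<l<i$. A representation $M$ is called almost generic if its $\mathrm{GL}(d)$-orbit is contained and dense in an irreducible component of $Y$. **Theorem.** The set $\mathcal O(d)$ is a single $\mathrm{GL}(d)$-orbit, and it is open and dense in $\mathcal R(Q,d)$. Moreover: (i) $Y=\bigcup_{(i,j)\in I(d)}Y_{i,j}$, and this is the decomposition of $Y$ into its irreducible components: the $Y_{i,j}$ with $(i,j)\in I(d)$ are pairwise different, and they are exactly the irreducible components of $Y$. (ii) For each $(i,j)\in J(d)$ there is a representation $M(i,j)$, unique up to isomorphism, whose orbit is contained and dense in $Y_{i,j}$. For $(i,j)\in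 I(d)$ the representation $M(i,j)$ is almost generic, and the component $Y_{i,j}$ is the closure of its orbit. (iii) For each $(i,j)\in J(d)$ the set $Y_{i,j}$ is closed and irreducible, of codimension $|d_j-d_i|+1$ in $\mathcal R(Q,d)$. (iv) The map $(i,j)\mapsto Y_{i,j}$ is a bijection from the set of pairs $i<j$ with $d_i=d_j$ and $d_l>d_i$ for all $i<l<j$ onto the set of irreducible components of $Y$ of codimension $1$. -/

import Mathlib

namespace QuiverA

/-- The representation space `R(Q,d)` of the equioriented quiver of type `A` with the `n + 1`
vertices `0, 1, …, n` (the vertices `1, …, t` of the usual numbering, `t = n + 1`) and the arrows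
`k + 1 ⟶ k`.  A representation `A` with dimension vector `d` consists of one matrix
`A k : K ^ d (k+1) → K ^ d k` for each arrow. -/
def Rep (K : Type*) {n : ℕ} (d : Fin (n + 1) → ℕ) : Type _ :=
  ∀ k : Fin n, Matrix (Fin (d k.castSucc)) (Fin (d k.succ)) K

variable {K : Type*} [Field K] {n : ℕ} {d : Fin (n + 1) → ℕ}

/-- The matrix of the composite map `A_(i,j) = A_{i,i+1} A_{i+1,i+2} ⋯ A_{j-1,j} : V_j → V_i`,
for `i ≤ j` (identity for `i = j`; the value for `j < i` is irrelevant and never used). -/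
def Rep.comp (A : Rep K d) (i : Fin (n + 1)) :
    ∀ j : Fin (n + 1), Matrix (Fin (d i)) (Fin (d j)) K :=
  Fin.induction (motive := fun j => Matrix (Fin (d i)) (Fin (d j)) K)
    (Matrix.of fun a b => if (a : ℕ) = (b : ℕ) then 1 else 0)
    (fun k B => if i ≤ k.castSucc then B * A k
      else Matrix.of fun a b => if (a : ℕ) = (b : ℕ) then 1 else 0)

theorem Rep.comp_succ (A : Rep K d) (i : Fin (n + 1)) (k : Fin n) (h : i ≤ k.castSucc) :
    A.comp i k.succ = A.comp i k.castSucc * A k := by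
  simp [Rep.comp, h]

theorem Rep.comp_self (A : Rep K d) (i : Fin (n + 1)) : A.comp i i = 1 := by
  induction i using Fin.cases with
  | zero => ext a b; simp [Rep.comp, Matrix.one_apply, Fin.ext_iff]
  | succ k =>
    ext a b
    simp [Rep.comp, Matrix.one_apply, Fin.ext_iff]

/-- The action of `g ∈ GL(d) = ∏ GL(d_i)` on the representation space, by change of bases. -/
def glAct (g : ∀ i, GL (Fin (d i)) K) (A : Rep K d) : Rep K d := fun k =>
  (g k.castSucc : Matrix (Fin (d k.castSucc)) (Fin (d k.castSucc)) K) * A k *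
    ((g k.succ)⁻¹ : GL (Fin (d k.succ)) K).1

/-- The `GL(d)`-orbit of a representation (its isomorphism class in `R(Q,d)`). -/
def glOrbit (A : Rep K d) : Set (Rep K d) := Set.range fun g => glAct g A

/-- The index set of the matrix entries: `R(Q,d)` is the affine space with these coordinates. -/
abbrev Coord {n : ℕ} (d : Fin (n + 1) → ℕ) : Type :=
  Σ k : Fin n, Fin (d k.castSucc) × Fin (d k.succ)

/-- The coordinate vector (all matrix entries) of a representation. -/
def coords (A : Rep K d) : Coord d → K := fun c => A c.1 c.2.1 c.2.2

/-- The Zariski topology on the affine space `R(Q,d)`: the closed sets are the common zero sets of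
polynomials in the matrix entries. -/
instance zariski : TopologicalSpace (Rep K d) :=
  TopologicalSpace.ofClosed
    {Z | ∃ S : Set (MvPolynomial (Coord d) K),
      Z = {A | ∀ p ∈ S, MvPolynomial.eval (coords A) p = 0}}
    ⟨{1}, by ext A; simp⟩
    (by
      intro T hT
      refine ⟨{p | ∃ Z ∈ T, ∀ A ∈ Z, MvPolynomial.eval (coords A) p = 0}, ?_⟩
      ext A
      constructor
      · rintro hA p ⟨Z, hZ, hp⟩
        exact hp A (hA Z hZ)
      · intro hA Z hZ
        obtain ⟨S, rfl⟩ := hT hZ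
        exact fun p hp => hA p ⟨_, hZ, fun B hB => hB p hp⟩)
    (by
      rintro _ ⟨S, rfl⟩ _ ⟨T, rfl⟩
      refine ⟨{r | ∃ p ∈ S, ∃ q ∈ T, r = p * q}, ?_⟩
      ext A
      constructor
      · rintro (h | h) r ⟨p, hp, q, hq, rfl⟩
        · simp [h p hp]
        · simp [h q hq]
      · intro h
        by_contra hne
        simp only [Set.mem_union, Set.mem_ofPred_eq, not_or, not_forall] at hne
        obtain ⟨⟨p, hp, hp'⟩, ⟨q, hq, hq'⟩⟩ := hne
        have := h (p * q) ⟨p, hp, q, hq, rfl⟩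
        rw [map_mul, mul_eq_zero] at this
        exact this.elim hp' hq')

/-- The irreducible components of a subset `Y` of `R(Q,d)`: its maximal irreducible subsets. -/
def components (Y : Set (Rep K d)) : Set (Set (Rep K d)) :=
  {Z | Maximal (fun W => IsIrreducible W ∧ W ⊆ Y) Z}

/-- The codimension in `R(Q,d)` of a Zariski closed subset: the height of its vanishing ideal in
the polynomial ring of the affine space `R(Q,d)`. -/
noncomputable def codim (Z : Set (Rep K d)) : ℕ∞ :=
  (MvPolynomial.vanishingIdeal K (coords '' Z)).height

/-- `r_{i,j} = min {d_l | i ≤ l ≤ j}`, for `i ≤ j`. -/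
noncomputable def minRank (d : Fin (n + 1) → ℕ) (i j : Fin (n + 1)) : ℕ := sInf (d '' Set.Icc i j)

/-- The generic orbit `O(d)`: all composites have the maximal possible rank. -/
def genericOrbit (K : Type*) [Field K] (d : Fin (n + 1) → ℕ) : Set (Rep K d) :=
  {A | ∀ i j, i < j → (A.comp i j).rank = minRank d i j}

/-- The complement `Y` of the generic orbit. -/
def complY (K : Type*) [Field K] (d : Fin (n + 1) → ℕ) : Set (Rep K d) := (genericOrbit K d)ᶜ

/-- `Y_{i,j}` for a pair `p = (i,j)`: the composite `A_(i,j)` has rank at most `r_{i,j} - 1`. -/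
def rankLocus (K : Type*) [Field K] (d : Fin (n + 1) → ℕ) (p : Fin (n + 1) × Fin (n + 1)) :
    Set (Rep K d) :=
  {A | (A.comp p.1 p.2).rank < minRank d p.1 p.2}

/-- The set `J(d)` of pairs `(i,j)`, `i < j`, with `d_l > max {d_i, d_j}` for all `i < l < j`. -/
def setJ (d : Fin (n + 1) → ℕ) : Set (Fin (n + 1) × Fin (n + 1)) :=
  {p | p.1 < p.2 ∧ ∀ l, p.1 < l → l < p.2 → max (d p.1) (d p.2) < d l}

/-- The set `I(d)`.  In the second case let `a > j` be the first place to the right of `j` with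
`d_a < d_i` (with `d = 0` beyond the last vertex, so that `a` is there if no vertex qualifies);
a vertex `l > j` satisfies `l < a` iff `d_i ≤ d_m` for all `j < m ≤ l`, and the condition is that
`d_j ≤ d_l` for all these `l`.  The third case is the mirror image. -/
def setI (d : Fin (n + 1) → ℕ) : Set (Fin (n + 1) × Fin (n + 1)) :=
  {p | p ∈ setJ d ∧
    (d p.1 = d p.2 ∨
      (d p.1 < d p.2 ∧
        ∀ l, p.2 < l → (∀ m, p.2 < m → m ≤ l → d p.1 ≤ d m) → d p.2 ≤ d l) ∨
      (d p.2 < d p.1 ∧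
        ∀ l, l < p.1 → (∀ m, l ≤ m → m < p.1 → d p.2 ≤ d m) → d p.1 ≤ d l))}

/-- The orbit of `M` is dense in the subset `Z`. -/
def DenseOrbitIn (M : Rep K d) (Z : Set (Rep K d)) : Prop :=
  glOrbit M ⊆ Z ∧ Z ⊆ closure (glOrbit M)

/-- `M` is almost generic: its orbit is dense in some irreducible component of `Y`. -/
def AlmostGeneric (M : Rep K d) : Prop :=
  ∃ Z ∈ components (complY K d), DenseOrbitIn M Z

end QuiverA

/-!
The irreducible closed sets in the representation space are studied through their points over the
infinite field `K`; no algebraic closure is needed.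

**Orbits.** A representation is determined up to isomorphism by the ranks of its composite maps
(`mem_glOrbit_of_rank_eq`): an isomorphism of the spaces at a vertex that respects the flag of
kernels of the composite maps out of that vertex can be extended along the next arrow, by
`exists_flag_equiv`. The conditions `rk ≥ r` are open, so in an irreducible set that is a union of
orbits the representations with all ranks maximal form a single orbit, open and dense in the set
(`exists_max_rank`, `exists_denseOrbitIn`). This gives the generic orbit and the representations
`M(i,j)` once the loci `Y_{i,j}` are known to be irreducible.

**Irreducibility.** Let `(i,j)` be in `J(d)` with `d_i ≤ d_j`. A representation lies in `Y_{i,j}` iff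
some nonzero covector at `i` is killed by `A_(i,j)`. A covector that dies before `j` can be made to
survive one vertex longer by deforming one arrow, since `d_l > d_j` for `i < l < j`
(`killLocus_subset_closure`). So the representations where some covector dies exactly at `j` are
dense in `Y_{i,j}`, and any two of these are joined by a polynomial path
(`isPreirreducible_killLocus`).

**Codimension.** Where a certain polynomial does not vanish, the equations of `Y_{i,j}` are linear in
`d_j - d_i + 1` of the matrix entries and determine these by the others. The vanishing ideal then
becomes the maximal ideal of a rational point after inverting the polynomials in the other entries,
so its height is the number of entries that were solved for (`height_eq_card_of_graph`,
`codim_rankLocus_of_le`). The case `d_i > d_j` follows by transposing all matrices and reversing the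
quiver (`dual`).

**Components.** If a rank condition fails, it fails on a pair in `J(d)` (`exists_mem_setJ`), and a
pair in `J(d)` outside `I(d)` can be lengthened so that `|d_j - d_i|` drops (`exists_mem_setI`). Hence
`Y` is the union of the irreducible closed sets `Y_{i,j}` with `(i,j)` in `I(d)`. There are no
inclusions among these, as each contains a representation that lies in no other `Y_{k,l}` with
`(k,l)` in `J(d)` (`exists_mem_rankLocus`).
-/

namespace QuiverA

open Matrix Polynomial

variable {K : Type*} [Field K] {n : ℕ} {d : Fin (n + 1) → ℕ}

/-! ### Composites along the quiver -/

/-- Induction on a vertex `j ≥ i`, starting at `i`. -/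
theorem le_succ_induction {i : Fin (n + 1)} {motive : ∀ j, i ≤ j → Prop} (self : motive i le_rfl)
    (succ : ∀ (k : Fin n) (h : i ≤ k.castSucc), motive k.castSucc h →
      motive k.succ (h.trans (Fin.castSucc_lt_succ).le)) :
    ∀ j h, motive j h := by
  intro j
  induction j using Fin.induction with
  | zero =>
    intro h
    obtain rfl : i = 0 := le_antisymm h (Fin.zero_le i)
    exact self
  | succ k ih =>
    intro h
    rcases eq_or_lt_of_le h with h' | h'
    · subst h'; exact self
    · exact succ k (Fin.le_castSucc_iff.2 h') (ih (Fin.le_castSucc_iff.2 h'))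

theorem Rep.comp_mul (A : Rep K d) {i l j : Fin (n + 1)} (hil : i ≤ l) (hlj : l ≤ j) :
    A.comp i j = A.comp i l * A.comp l j := by
  induction j, hlj using le_succ_induction with
  | self => rw [Rep.comp_self, Matrix.mul_one]
  | succ k h ih => rw [A.comp_succ i k (hil.trans h), A.comp_succ l k h, ih, Matrix.mul_assoc]

theorem Rep.comp_arrow (A : Rep K d) (k : Fin n) : A.comp k.castSucc k.succ = A k := by
  rw [A.comp_succ _ k le_rfl, Rep.comp_self, Matrix.one_mul]

theorem Rep.comp_castSucc (A : Rep K d) (k : Fin n) {j : Fin (n + 1)} (h : k.succ ≤ j) :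
    A.comp k.castSucc j = A k * A.comp k.succ j := by
  rw [A.comp_mul Fin.castSucc_lt_succ.le h, A.comp_arrow]

theorem Rep.comp_congr {A B : Rep K d} {i j : Fin (n + 1)} (hij : i ≤ j)
    (h : ∀ k : Fin n, i ≤ k.castSucc → k.succ ≤ j → A k = B k) : A.comp i j = B.comp i j := by
  induction j, hij using le_succ_induction with
  | self => rw [Rep.comp_self, Rep.comp_self]
  | succ k hk ih =>
    rw [A.comp_succ _ _ hk, B.comp_succ _ _ hk, h k hk le_rfl,
      ih fun l hl hl' => h l hl (hl'.trans Fin.castSucc_lt_succ.le)]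

theorem Rep.comp_glAct (g : ∀ i, GL (Fin (d i)) K) (A : Rep K d) {i j : Fin (n + 1)}
    (hij : i ≤ j) :
    (glAct g A).comp i j = (g i).1 * A.comp i j * ((g j)⁻¹ : GL (Fin (d j)) K).1 := by
  induction j, hij using le_succ_induction with
  | self => rw [Rep.comp_self, Rep.comp_self, Matrix.mul_one, Units.mul_inv]
  | succ k hk ih =>
    rw [Rep.comp_succ _ _ _ hk, Rep.comp_succ _ _ _ hk, ih, glAct]
    simp only [Matrix.mul_assoc]
    rw [← Matrix.mul_assoc ((g k.castSucc)⁻¹ : GL (Fin (d k.castSucc)) K).1, Units.inv_mul,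
      Matrix.one_mul]

theorem Rep.rank_comp_glAct (g : ∀ i, GL (Fin (d i)) K) (A : Rep K d) {i j : Fin (n + 1)}
    (hij : i ≤ j) : ((glAct g A).comp i j).rank = (A.comp i j).rank := by
  rw [Rep.comp_glAct g A hij,
    Matrix.rank_mul_eq_left_of_isUnit_det _ _ ((Matrix.isUnit_iff_isUnit_det _).1 (Units.isUnit _)),
    Matrix.rank_mul_eq_right_of_isUnit_det _ _ ((Matrix.isUnit_iff_isUnit_det _).1 (Units.isUnit _))]

/-! ### Rank bounds -/

theorem minRank_le {i j l : Fin (n + 1)} (hil : i ≤ l) (hlj : l ≤ j) : minRank d i j ≤ d l :=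
  Nat.sInf_le ⟨l, ⟨hil, hlj⟩, rfl⟩

theorem le_minRank_iff {i j : Fin (n + 1)} (hij : i ≤ j) {m : ℕ} :
    m ≤ minRank d i j ↔ ∀ l, i ≤ l → l ≤ j → m ≤ d l := by
  refine ⟨fun h l hil hlj => h.trans (minRank_le hil hlj), fun h => ?_⟩
  have : minRank d i j ∈ d '' Set.Icc i j := Nat.sInf_mem ⟨d i, i, ⟨le_rfl, hij⟩, rfl⟩
  obtain ⟨l, hl, hl'⟩ := this
  exact hl' ▸ h l hl.1 hl.2

theorem Rep.rank_comp_le (A : Rep K d) {i j : Fin (n + 1)} (hij : i ≤ j) :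
    (A.comp i j).rank ≤ minRank d i j := by
  rw [le_minRank_iff hij]
  intro l hil hlj
  rw [A.comp_mul hil hlj]
  exact (Matrix.rank_mul_le_left _ _).trans (Matrix.rank_le_width _)

theorem rank_lt_iff_exists_vecMul_eq_zero {m p : ℕ} (B : Matrix (Fin m) (Fin p) K) :
    B.rank < m ↔ ∃ w : Fin m → K, w ≠ 0 ∧ w ᵥ* B = 0 := by
  have h := LinearMap.finrank_range_add_finrank_ker (Bᵀ.mulVecLin)
  rw [← Matrix.rank_transpose]
  change Bᵀ.rank + _ = _ at h
  rw [Module.finrank_fin_fun] at h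
  have h2 : Module.finrank K (LinearMap.ker Bᵀ.mulVecLin) ≠ 0 ↔
      LinearMap.ker Bᵀ.mulVecLin ≠ ⊥ := by rw [Ne, Submodule.finrank_eq_zero]
  rw [show Bᵀ.rank < m ↔ Module.finrank K (LinearMap.ker Bᵀ.mulVecLin) ≠ 0 by omega, h2,
    Submodule.ne_bot_iff]
  simp only [LinearMap.mem_ker, Matrix.mulVecLin_apply, Matrix.mulVec_transpose]
  exact ⟨fun ⟨w, h, h'⟩ => ⟨w, h', h⟩, fun ⟨w, h, h'⟩ => ⟨w, h', h⟩⟩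

/-- A rank condition from below is the nonvanishing of some of the determinants `det (P B Q)` with
constant `P` and `Q`; this form avoids minors, and shows at once that the condition is open. -/
theorem le_rank_iff_exists_det_ne_zero {m p : ℕ} (B : Matrix (Fin m) (Fin p) K) (r : ℕ) :
    r ≤ B.rank ↔ ∃ (P : Matrix (Fin r) (Fin m) K) (Q : Matrix (Fin p) (Fin r) K),
      (P * B * Q).det ≠ 0 := by
  constructor
  · intro h
    obtain ⟨f, hf⟩ := exists_linearIndependent_of_le_finrank
      (R := K) (M := LinearMap.range B.mulVecLin) h
    have hf' : LinearIndependent K fun i => (f i : Fin m → K) :=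
      hf.map' (Submodule.subtype _) (Submodule.ker_subtype _)
    choose q hq using fun i => (f i).2
    let Q : Matrix (Fin p) (Fin r) K := Matrix.of fun a b => q b a
    have hBQ : (B * Q).col = fun i => (f i : Fin m → K) := by
      funext b a
      rw [← hq b]
      rfl
    have hinj : LinearIndependent K (B * Q)ᵀ.row := by
      change LinearIndependent K (B * Q).col
      rw [hBQ]; exact hf'
    have hrk : (B * Q)ᵀ.rank = r := by rw [hinj.rank_matrix, Fintype.card_fin]
    have hsurj : Function.Surjective fun v => v ᵥ* (B * Q) := by
      have : LinearMap.range ((B * Q)ᵀ.mulVecLin) = ⊤ :=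
        Submodule.eq_top_of_finrank_eq (by rw [Module.finrank_fin_fun]; exact hrk)
      intro y
      obtain ⟨x, hx⟩ := LinearMap.range_eq_top.1 this y
      exact ⟨x, by rw [← hx]; simp⟩
    obtain ⟨P, hP⟩ := Matrix.vecMul_surjective_iff_exists_left_inverse.1 hsurj
    exact ⟨P, Q, by rw [Matrix.mul_assoc, hP, Matrix.det_one]; exact one_ne_zero⟩
  · rintro ⟨P, Q, h⟩
    have h1 := Matrix.rank_of_det_ne_zero h
    rw [Fintype.card_fin] at h1
    rw [← h1]
    exact (Matrix.rank_mul_le_left _ _).trans (Matrix.rank_mul_le_right _ _)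

/-! ### Regular functions and the Zariski topology -/

/-- The representation with given matrix entries. -/
def ofCoords {K : Type*} (x : Coord d → K) : Rep K d := fun k => Matrix.of fun a b => x ⟨k, a, b⟩

@[simp] theorem coords_ofCoords {K : Type*} (x : Coord d → K) : coords (ofCoords x) = x := rfl

@[simp] theorem ofCoords_coords {K : Type*} (A : Rep K d) : ofCoords (coords A) = A := rfl

/-- The algebra of regular functions on the representation space: the functions given by
polynomials in the matrix entries. -/
noncomputable def regular (K : Type*) [Field K] (d : Fin (n + 1) → ℕ) :
    Subalgebra K (Rep K d → K) :=
  (MvPolynomial.aeval (R := K) fun (c : Coord d) (A : Rep K d) => coords A c).range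

theorem mem_regular_iff {f : Rep K d → K} :
    f ∈ regular K d ↔ ∃ p : MvPolynomial (Coord d) K, ∀ A, f A = MvPolynomial.eval (coords A) p := by
  have key : ∀ (p : MvPolynomial (Coord d) K) (A : Rep K d),
      MvPolynomial.aeval (R := K) (fun (c : Coord d) (A : Rep K d) => coords A c) p A =
        MvPolynomial.eval (coords A) p := by
    intro p A
    induction p using MvPolynomial.induction_on with
    | C a => simp
    | add p q hp hq => simp [hp, hq]
    | mul_X p c hp => simp [hp]
  constructor
  · rintro ⟨p, rfl⟩
    exact ⟨p, key p⟩
  · rintro ⟨p, hp⟩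
    exact ⟨p, funext fun A => (key p A).trans (hp A).symm⟩

theorem entry_mem_regular (k : Fin n) (a : Fin (d k.castSucc)) (b : Fin (d k.succ)) :
    (fun A : Rep K d => A k a b) ∈ regular K d :=
  mem_regular_iff.2 ⟨MvPolynomial.X ⟨k, a, b⟩, fun A => by simp [coords]⟩

theorem const_mem_regular (x : K) : (fun _ : Rep K d => x) ∈ regular K d :=
  (regular K d).algebraMap_mem x

theorem isClosed_iff {Z : Set (Rep K d)} : IsClosed Z ↔
    ∃ S : Set (MvPolynomial (Coord d) K), Z = {A | ∀ p ∈ S, MvPolynomial.eval (coords A) p = 0} := by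
  rw [← isOpen_compl_iff]
  change Zᶜᶜ ∈ _ ↔ _
  rw [compl_compl]
  rfl

theorem isClosed_zero {f : Rep K d → K} (hf : f ∈ regular K d) : IsClosed {A | f A = 0} := by
  obtain ⟨p, hp⟩ := mem_regular_iff.1 hf
  exact isClosed_iff.2 ⟨{p}, by ext A; simp [hp]⟩

theorem isOpen_ne_zero {f : Rep K d → K} (hf : f ∈ regular K d) : IsOpen {A | f A ≠ 0} :=
  (isClosed_zero hf).isOpen_compl

theorem exists_regular_of_isOpen {U : Set (Rep K d)} (hU : IsOpen U) {A : Rep K d} (hA : A ∈ U) :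
    ∃ p : MvPolynomial (Coord d) K, MvPolynomial.eval (coords A) p ≠ 0 ∧
      ∀ B, MvPolynomial.eval (coords B) p ≠ 0 → B ∈ U := by
  obtain ⟨S, hS⟩ := isClosed_iff.1 hU.isClosed_compl
  have : A ∉ Uᶜ := fun h => h hA
  rw [hS] at this
  simp only [Set.mem_ofPred_eq, not_forall] at this
  obtain ⟨p, hp, hp'⟩ := this
  refine ⟨p, hp', fun B hB => ?_⟩
  by_contra hBU
  have : B ∈ Uᶜ := hBU
  rw [hS] at this
  exact hB (this p hp)

theorem comp_entry_mem_regular {i j : Fin (n + 1)} (hij : i ≤ j) (a : Fin (d i)) (b : Fin (d j)) :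
    (fun A : Rep K d => A.comp i j a b) ∈ regular K d := by
  induction j, hij using le_succ_induction with
  | self => simp only [Rep.comp_self]; exact const_mem_regular _
  | succ k hk ih =>
    have : (fun A : Rep K d => A.comp i k.succ a b) =
        ∑ c, (fun A : Rep K d => A.comp i k.castSucc a c) * fun A : Rep K d => A k c b := by
      funext A
      rw [Rep.comp_succ _ _ _ hk, Matrix.mul_apply, Finset.sum_apply]
      rfl
    rw [this]
    exact Subalgebra.sum_mem _ fun c _ => Subalgebra.mul_mem _ (ih c) (entry_mem_regular _ _ _)

theorem mul_entry_mem {R : Type*} {S : Subalgebra K (R → K)} {m p q : Type*} [Fintype p]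
    {B : R → Matrix m p K} {C : R → Matrix p q K} (hB : ∀ a b, (fun x => B x a b) ∈ S)
    (hC : ∀ a b, (fun x => C x a b) ∈ S) (a : m) (b : q) : (fun x => (B x * C x) a b) ∈ S := by
  have : (fun x => (B x * C x) a b) = ∑ c, (fun x => B x a c) * fun x => C x c b := by
    funext x
    rw [Matrix.mul_apply, Finset.sum_apply]
    rfl
  rw [this]
  exact Subalgebra.sum_mem _ fun c _ => Subalgebra.mul_mem _ (hB _ _) (hC _ _)

theorem det_mem {R : Type*} {S : Subalgebra K (R → K)} {m : Type*} [Fintype m] [DecidableEq m]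
    {B : R → Matrix m m K} (hB : ∀ a b, (fun x => B x a b) ∈ S) : (fun x => (B x).det) ∈ S := by
  have : (fun x => (B x).det) =
      ∑ σ : Equiv.Perm m, ((Equiv.Perm.sign σ : ℤ) : K) • ∏ i, fun x => B x (σ i) i := by
    funext x
    rw [Matrix.det_apply, Finset.sum_apply]
    refine Finset.sum_congr rfl fun σ _ => ?_
    rw [Pi.smul_apply, Finset.prod_apply, Units.smul_def, zsmul_eq_mul, smul_eq_mul]
  rw [this]
  exact Subalgebra.sum_mem _ fun σ _ =>
    Subalgebra.smul_mem _ (Subalgebra.prod_mem _ fun i _ => hB _ _) _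

theorem isOpen_le_rank {i j : Fin (n + 1)} (hij : i ≤ j) (r : ℕ) :
    IsOpen {A : Rep K d | r ≤ (A.comp i j).rank} := by
  simp only [le_rank_iff_exists_det_ne_zero, Set.ofPred_exists]
  refine isOpen_iUnion fun P => isOpen_iUnion fun Q => isOpen_ne_zero (det_mem ?_)
  exact mul_entry_mem (mul_entry_mem (fun _ _ => const_mem_regular _)
    fun _ _ => comp_entry_mem_regular hij _ _) fun _ _ => const_mem_regular _

theorem isClosed_rankLocus {p : Fin (n + 1) × Fin (n + 1)} (hp : p.1 ≤ p.2) :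
    IsClosed (rankLocus K d p) := by
  have h := (isOpen_le_rank (K := K) (d := d) hp (minRank d p.1 p.2)).isClosed_compl
  convert h using 1
  ext A
  simp [rankLocus]

/-! ### Polynomial paths -/

/-- The polynomial functions on the affine line. -/
noncomputable def polyFun (K : Type*) [Field K] : Subalgebra K (K → K) :=
  (Polynomial.aeval (R := K) (id : K → K)).range

theorem mem_polyFun_iff {f : K → K} : f ∈ polyFun K ↔ ∃ p : K[X], ∀ s, f s = p.eval s := by
  have key : ∀ (p : K[X]) (s : K), Polynomial.aeval (R := K) (id : K → K) p s = p.eval s := by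
    intro p s
    induction p using Polynomial.induction_on' with
    | add p q hp hq => simp_all
    | monomial k a => simp [Polynomial.aeval_monomial]
  constructor
  · rintro ⟨p, rfl⟩
    exact ⟨p, key p⟩
  · rintro ⟨p, hp⟩
    exact ⟨p, funext fun A => (key p A).trans (hp A).symm⟩

theorem const_mem_polyFun (x : K) : (fun _ : K => x) ∈ polyFun K :=
  (polyFun K).algebraMap_mem x

theorem id_mem_polyFun : (fun s : K => s) ∈ polyFun K :=
  mem_polyFun_iff.2 ⟨Polynomial.X, by simp⟩

/-- The linear path from `x` to `y` in `K`. -/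
def lin (x y s : K) : K := (1 - s) * x + s * y

@[simp] theorem lin_zero (x y : K) : lin x y 0 = x := by simp [lin]

@[simp] theorem lin_one (x y : K) : lin x y 1 = y := by simp [lin]

theorem lin_mem_polyFun (x y : K) : lin x y ∈ polyFun K :=
  (polyFun K).add_mem ((polyFun K).mul_mem ((polyFun K).sub_mem (const_mem_polyFun 1)
    id_mem_polyFun) (const_mem_polyFun x)) ((polyFun K).mul_mem id_mem_polyFun (const_mem_polyFun y))

/-- A polynomial path in the representation space: all matrix entries are polynomials in the
parameter. -/
def IsPolyPath (φ : K → Rep K d) : Prop := ∀ k a b, (fun s => φ s k a b) ∈ polyFun K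

theorem IsPolyPath.eval_mem {φ : K → Rep K d} (h : IsPolyPath φ) (p : MvPolynomial (Coord d) K) :
    (fun s => MvPolynomial.eval (coords (φ s)) p) ∈ polyFun K := by
  induction p using MvPolynomial.induction_on with
  | C a => simpa using const_mem_polyFun a
  | add p q hp hq =>
    simp only [map_add]
    exact (polyFun K).add_mem hp hq
  | mul_X p c hp => 
    simp only [map_mul, MvPolynomial.eval_X]
    exact (polyFun K).mul_mem hp (h c.1 c.2.1 c.2.2)

theorem IsPolyPath.exists_of_isOpen {φ : K → Rep K d} (h : IsPolyPath φ) {U : Set (Rep K d)}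
    (hU : IsOpen U) {s₀ : K} (hs : φ s₀ ∈ U) :
    ∃ f : K[X], f ≠ 0 ∧ ∀ s, f.eval s ≠ 0 → φ s ∈ U := by
  obtain ⟨p, hp, hp'⟩ := exists_regular_of_isOpen hU hs
  obtain ⟨f, hf⟩ := mem_polyFun_iff.1 (h.eval_mem p)
  refine ⟨f, ?_, fun s hs => hp' _ (by rw [hf]; exact hs)⟩
  rintro rfl
  exact hp (by rw [hf s₀]; simp)

section Infinite

variable [Infinite K]

theorem exists_eval_ne_zero {f : K[X]} (hf : f ≠ 0) : ∃ s, f.eval s ≠ 0 := by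
  by_contra! h
  exact hf (Polynomial.funext fun s => by simpa using h s)

/-- The limit at a point of a polynomial path lies in the closure of any set that contains the rest
of the path. -/
theorem IsPolyPath.mem_closure {φ : K → Rep K d} (h : IsPolyPath φ) {S : Set (Rep K d)}
    (g : K[X]) (hg : g ≠ 0) (hS : ∀ s, g.eval s ≠ 0 → φ s ∈ S) (s₀ : K) : φ s₀ ∈ closure S := by
  rw [mem_closure_iff]
  intro U hU hs
  obtain ⟨f, hf, hf'⟩ := h.exists_of_isOpen hU hs
  obtain ⟨s, hs⟩ := exists_eval_ne_zero (mul_ne_zero hf hg)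
  rw [Polynomial.eval_mul, mul_ne_zero_iff] at hs
  exact ⟨φ s, hf' s hs.1, hS s hs.2⟩

/-- A set is irreducible if any two of its points are joined by a polynomial path that stays in
the set for all but finitely many parameters. -/
theorem isPreirreducible_of_paths {S : Set (Rep K d)}
    (h : ∀ A ∈ S, ∀ B ∈ S, ∃ φ : K → Rep K d, IsPolyPath φ ∧ φ 0 = A ∧ φ 1 = B ∧
      ∃ g : K[X], g ≠ 0 ∧ ∀ s, g.eval s ≠ 0 → φ s ∈ S) : IsPreirreducible S := by
  rintro U V hU hV ⟨A, hAS, hAU⟩ ⟨B, hBS, hBV⟩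
  obtain ⟨φ, hφ, h0, h1, g, hg, hgS⟩ := h A hAS B hBS
  obtain ⟨f, hf, hf'⟩ := hφ.exists_of_isOpen hU (s₀ := 0) (h0 ▸ hAU)
  obtain ⟨f₁, hf₁, hf₁'⟩ := hφ.exists_of_isOpen hV (s₀ := 1) (h1 ▸ hBV)
  obtain ⟨s, hs⟩ := exists_eval_ne_zero (mul_ne_zero (mul_ne_zero hf hf₁) hg)
  simp only [Polynomial.eval_mul, mul_ne_zero_iff] at hs
  exact ⟨φ s, hgS s hs.2, hf' s hs.1.1, hf₁' s hs.1.2⟩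

theorem isPreirreducible_univ : IsPreirreducible (Set.univ : Set (Rep K d)) := by
  refine isPreirreducible_of_paths fun A _ B _ =>
    ⟨fun s k => Matrix.of fun a b => lin (A k a b) (B k a b) s, fun k a b => lin_mem_polyFun _ _,
      ?_, ?_, 1, one_ne_zero, fun _ _ => Set.mem_univ _⟩ <;>
  · funext k
    ext a b
    simp

end Infinite

/-! ### Representations with the same ranks are isomorphic -/

section Flags

variable {V V' : Type*} [AddCommGroup V] [Module K V] [AddCommGroup V'] [Module K V']

theorem exists_factor {W : Type*} [AddCommGroup W] [Module K W] (f : W →ₗ[K] V) (g : W →ₗ[K] V')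
    (h : ∀ x, f x = 0 → g x = 0) : ∃ Ψ : V →ₗ[K] V', ∀ x, Ψ (f x) = g x := by
  obtain ⟨s, hs⟩ := f.rangeRestrict.exists_rightInverse_of_surjective f.range_rangeRestrict
  obtain ⟨Ψ, hΨ⟩ := LinearMap.exists_extend (g ∘ₗ s)
  refine ⟨Ψ, fun x => ?_⟩
  have h1 : Ψ (f x) = g (s (f.rangeRestrict x)) := LinearMap.congr_fun hΨ (f.rangeRestrict x)
  have h2 : f (s (f.rangeRestrict x)) = f x :=
    congrArg Subtype.val (LinearMap.congr_fun hs (f.rangeRestrict x))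
  rw [h1, ← sub_eq_zero, ← map_sub]
  exact h _ (by rw [map_sub, h2, sub_self])

theorem finrank_inf_eq {U G : Submodule K V} {G' : Submodule K V'} (Ψ : V →ₗ[K] V')
    (hinj : ∀ x ∈ U, Ψ x = 0 → x = 0) (hG : ∀ x ∈ U, (Ψ x ∈ G' ↔ x ∈ G)) :
    Module.finrank K (U.map Ψ ⊓ G' : Submodule K V') =
      Module.finrank K (U ⊓ G : Submodule K V) := by
  have h1 : U.map Ψ ⊓ G' = (U ⊓ G).map Ψ := by
    ext y
    simp only [Submodule.mem_inf, Submodule.mem_map]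
    constructor
    · rintro ⟨⟨x, hx, rfl⟩, hy⟩
      exact ⟨x, ⟨hx, (hG x hx).1 hy⟩, rfl⟩
    · rintro ⟨x, ⟨hx, hx'⟩, rfl⟩
      exact ⟨⟨x, hx, rfl⟩, (hG x hx).2 hx'⟩
  rw [h1, ← LinearMap.range_domRestrict]
  refine LinearMap.finrank_range_of_inj fun x y hxy => ?_
  have := hinj (x - y : V) (U.sub_mem x.2.1 y.2.1) (by
    rw [map_sub, sub_eq_zero]; exact hxy)
  exact Subtype.ext (sub_eq_zero.1 this)

variable [FiniteDimensional K V] [FiniteDimensional K V']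

/-- One step of the extension of a flag preserving partial isomorphism `Ψ`, defined on `U`, by a
vector of `G`, where `G` is a member of the flag with all smaller members contained in `U`. -/
theorem exists_extension_step {ι : Type*} {F : ι → Submodule K V} {F' : ι → Submodule K V'}
    (hdim : ∀ i, Module.finrank K (F i) = Module.finrank K (F' i)) {U : Submodule K V}
    (Ψ : V →ₗ[K] V') (hinj : ∀ x ∈ U, Ψ x = 0 → x = 0)
    (hF : ∀ i, ∀ x ∈ U, (Ψ x ∈ F' i ↔ x ∈ F i)) {G : Submodule K V} {G' : Submodule K V'}
    (hGG' : Module.finrank K G = Module.finrank K G') (hG : ∀ x ∈ U, (Ψ x ∈ G' ↔ x ∈ G))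
    (hGU : ¬ G ≤ U) (hle : ∀ i, (G ≤ F i ∧ G' ≤ F' i) ∨ F i ≤ U) :
    ∃ (U₁ : Submodule K V) (Ψ₁ : V →ₗ[K] V'), U < U₁ ∧ (∀ x ∈ U, Ψ₁ x = Ψ x) ∧
      (∀ x ∈ U₁, Ψ₁ x = 0 → x = 0) ∧ ∀ i, ∀ x ∈ U₁, (Ψ₁ x ∈ F' i ↔ x ∈ F i) := by
  obtain ⟨x, hxG, hxU⟩ := SetLike.not_le_iff_exists.1 hGU
  have hG'U : ¬ G' ≤ U.map Ψ := by
    intro hle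
    have h1 := finrank_inf_eq Ψ hinj hG
    rw [inf_eq_right.2 hle, ← hGG'] at h1
    have h2 : U ⊓ G = G := Submodule.eq_of_le_of_finrank_eq inf_le_right h1.symm
    exact hGU (inf_eq_right.1 h2)
  obtain ⟨y, hyG, hyU⟩ := SetLike.not_le_iff_exists.1 hG'U
  obtain ⟨φ, hφx, hφU⟩ := Submodule.exists_le_ker_of_notMem hxU
  let Ψ₁ : V →ₗ[K] V' := Ψ + ((φ x)⁻¹ • φ).smulRight (y - Ψ x)
  have hΨ₁U : ∀ u ∈ U, Ψ₁ u = Ψ u := fun u hu => by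
    have : φ u = 0 := hφU hu
    simp [Ψ₁, this]
  have hΨ₁x : Ψ₁ x = y := by simp [Ψ₁, inv_mul_cancel₀ hφx]
  have hmem : ∀ z ∈ U ⊔ K ∙ x, ∃ u ∈ U, ∃ t : K, z = u + t • x := by
    intro z hz
    obtain ⟨u, hu, v, hv, rfl⟩ := Submodule.mem_sup.1 hz
    obtain ⟨t, rfl⟩ := Submodule.mem_span_singleton.1 hv
    exact ⟨u, hu, t, rfl⟩
  have hval : ∀ u ∈ U, ∀ t : K, Ψ₁ (u + t • x) = Ψ u + t • y := fun u hu t => by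
    rw [map_add, map_smul, hΨ₁U u hu, hΨ₁x]
  -- a combination `Ψ u + t • y` in the image of `U` has `t = 0`, as `y` is not in that image
  have ht0 : ∀ u ∈ U, ∀ t : K, Ψ u + t • y ∈ U.map Ψ → t = 0 := by
    intro u hu t h
    by_contra ht
    have h1 : t • y ∈ U.map Ψ :=
      (Submodule.add_mem_iff_right _ (Submodule.mem_map_of_mem hu)).1 h
    exact hyU ((Submodule.smul_mem_iff _ ht).1 h1)
  refine ⟨U ⊔ K ∙ x, Ψ₁, ?_, hΨ₁U, ?_, ?_⟩
  · refine lt_of_le_of_ne le_sup_left fun h => hxU ?_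
    rw [h]
    exact Submodule.mem_sup_right (Submodule.mem_span_singleton_self x)
  · intro z hz h0
    obtain ⟨u, hu, t, rfl⟩ := hmem z hz
    rw [hval u hu] at h0
    obtain rfl := ht0 u hu t (by rw [h0]; exact zero_mem _)
    rw [zero_smul, add_zero] at h0 ⊢
    exact hinj u hu h0
  · intro i z hz
    obtain ⟨u, hu, t, rfl⟩ := hmem z hz
    rw [hval u hu]
    rcases hle i with ⟨h1, h2⟩ | h1
    · rw [Submodule.add_mem_iff_left _ (Submodule.smul_mem _ _ (h2 hyG)),
        Submodule.add_mem_iff_left _ (Submodule.smul_mem _ _ (h1 hxG)), hF i u hu]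
    · have h2 : F' i ≤ U.map Ψ := by
        have h := finrank_inf_eq Ψ hinj (hF i)
        rw [inf_eq_right.2 h1, hdim i] at h
        exact inf_eq_right.1 (Submodule.eq_of_le_of_finrank_eq inf_le_right h)
      have h3 : Ψ u + t • y ∈ F' i → t = 0 := fun h => ht0 u hu t (h2 h)
      have h4 : u + t • x ∈ F i → t = 0 := fun h => by
        by_contra ht
        exact hxU ((Submodule.smul_mem_iff _ ht).1
          ((Submodule.add_mem_iff_right _ hu).1 (h1 h)))
      constructor
      · intro h
        obtain rfl := h3 h
        rw [zero_smul, add_zero] at h ⊢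
        exact (hF i u hu).1 h
      · intro h
        obtain rfl := h4 h
        rw [zero_smul, add_zero] at h ⊢
        exact (hF i u hu).2 h

/-- An isomorphism between subspaces that is compatible with two flags of the same dimensions
extends to an isomorphism of the whole spaces that is compatible with the flags. -/
theorem exists_flag_equiv {ι : Type*} [LinearOrder ι] [Finite ι] {F : ι → Submodule K V}
    {F' : ι → Submodule K V'} (hanti : Antitone F) (hanti' : Antitone F')
    (hV : Module.finrank K V = Module.finrank K V')
    (hdim : ∀ i, Module.finrank K (F i) = Module.finrank K (F' i)) (U : Submodule K V)
    (Ψ : V →ₗ[K] V') (hinj : ∀ x ∈ U, Ψ x = 0 → x = 0)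
    (hF : ∀ i, ∀ x ∈ U, (Ψ x ∈ F' i ↔ x ∈ F i)) :
    ∃ Φ : V ≃ₗ[K] V', (∀ x ∈ U, Φ x = Ψ x) ∧ ∀ i x, Φ x ∈ F' i ↔ x ∈ F i := by
  induction U using (wellFounded_gt (α := Submodule K V)).induction generalizing Ψ with
  | _ U ih =>
  by_cases hU : U = ⊤
  · subst hU
    have hi : Function.Injective Ψ :=
      (injective_iff_map_eq_zero Ψ).2 fun x hx => hinj x Submodule.mem_top hx
    exact ⟨LinearEquiv.ofBijective Ψ
      ⟨hi, (LinearMap.injective_iff_surjective_of_finrank_eq_finrank hV).1 hi⟩,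
      fun _ _ => rfl, fun i x => hF i x Submodule.mem_top⟩
  · have hstep : ∃ (U₁ : Submodule K V) (Ψ₁ : V →ₗ[K] V'), U < U₁ ∧ (∀ x ∈ U, Ψ₁ x = Ψ x) ∧
        (∀ x ∈ U₁, Ψ₁ x = 0 → x = 0) ∧ ∀ i, ∀ x ∈ U₁, (Ψ₁ x ∈ F' i ↔ x ∈ F i) := by
      by_cases h : ∃ i, ¬ F i ≤ U
      · obtain ⟨i, hi, hmax⟩ := (Set.toFinite {i | ¬ F i ≤ U}).exists_maximal h
        refine exists_extension_step hdim Ψ hinj hF (hdim i) (hF i) hi fun k => ?_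
        rcases le_or_gt k i with hk | hk
        · exact Or.inl ⟨hanti hk, hanti' hk⟩
        · refine Or.inr (not_not.1 fun hk' => ?_)
          exact absurd (hmax hk' hk.le) (not_le.2 hk)
      · push Not at h
        exact exists_extension_step (G := ⊤) (G' := ⊤) hdim Ψ hinj hF
          (by rw [finrank_top, finrank_top, hV]) (by simp)
          (fun h => hU (top_le_iff.1 h)) fun k => Or.inr (h k)
    obtain ⟨U₁, Ψ₁, hlt, hag, hinj₁, hF₁⟩ := hstep
    obtain ⟨Φ, hΦ, hΦ'⟩ := ih U₁ hlt Ψ₁ hinj₁ hF₁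
    exact ⟨Φ, fun x hx => (hΦ x (hlt.le hx)).trans (hag x hx), hΦ'⟩

end Flags

/-- The kernel at the vertex `l` of the composite map to the vertex `i`.  For fixed `l` these
subspaces form a flag. -/
noncomputable def Rep.kerFlag (A : Rep K d) (l : Fin (n + 1)) (i : Set.Iic l) :
    Submodule K (Fin (d l) → K) :=
  LinearMap.ker (A.comp i l).mulVecLin

theorem Rep.mem_kerFlag {A : Rep K d} {l : Fin (n + 1)} {i : Set.Iic l} {x : Fin (d l) → K} :
    x ∈ A.kerFlag l i ↔ A.comp i l *ᵥ x = 0 := LinearMap.mem_ker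

theorem Rep.kerFlag_antitone (A : Rep K d) (l : Fin (n + 1)) : Antitone (A.kerFlag l) := by
  intro i j hij x hx
  rw [Rep.mem_kerFlag] at hx ⊢
  rw [A.comp_mul hij j.2, ← Matrix.mulVec_mulVec, hx, Matrix.mulVec_zero]

theorem Rep.finrank_kerFlag (A : Rep K d) (l : Fin (n + 1)) (i : Set.Iic l) :
    (A.comp i l).rank + Module.finrank K (A.kerFlag l i) = d l := by
  have := LinearMap.finrank_range_add_finrank_ker (A.comp i l).mulVecLin
  rwa [Module.finrank_fin_fun] at this

theorem Rep.finrank_kerFlag_eq {A B : Rep K d}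
    (h : ∀ i j, i ≤ j → (A.comp i j).rank = (B.comp i j).rank) (l : Fin (n + 1)) (i : Set.Iic l) :
    Module.finrank K (A.kerFlag l i) = Module.finrank K (B.kerFlag l i) := by
  have h1 := A.finrank_kerFlag l i
  have h2 := B.finrank_kerFlag l i
  have h3 := h i l i.2
  omega

/-- The isomorphisms between the spaces of `A` and `B` at the vertex `l` that are compatible with
the flags of kernels; these are the ones that extend to all vertices below `l`. -/
abbrev FlagIso (A B : Rep K d) (l : Fin (n + 1)) : Type _ :=
  {Φ : (Fin (d l) → K) ≃ₗ[K] (Fin (d l) → K) //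
    ∀ i x, Φ x ∈ B.kerFlag l i ↔ x ∈ A.kerFlag l i}

/-- The isomorphism at the head of the arrow `k` is prescribed on the image of `A k`; it is extended
to the whole space by `exists_flag_equiv`. -/
theorem FlagIso.exists_step {A B : Rep K d}
    (h : ∀ i j, i ≤ j → (A.comp i j).rank = (B.comp i j).rank) (k : Fin n)
    (Φ : FlagIso A B k.succ) :
    ∃ Φ' : FlagIso A B k.castSucc, ∀ x, Φ'.1 (A k *ᵥ x) = B k *ᵥ Φ.1 x := by
  have hk : k.castSucc ≤ k.succ := Fin.castSucc_lt_succ.le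
  have hflag : ∀ i : Set.Iic k.castSucc, ∀ x, B.comp i k.castSucc *ᵥ (B k *ᵥ Φ.1 x) = 0 ↔
      A.comp i k.castSucc *ᵥ (A k *ᵥ x) = 0 := fun i x => by
    rw [Matrix.mulVec_mulVec, Matrix.mulVec_mulVec, ← Rep.comp_succ _ _ _ i.2,
      ← Rep.comp_succ _ _ _ i.2]
    exact Φ.2 ⟨i, i.2.trans hk⟩ x
  have hker : ∀ x, B k *ᵥ Φ.1 x = 0 ↔ A k *ᵥ x = 0 := fun x => by
    simpa [Rep.comp_self] using hflag ⟨k.castSucc, Set.self_mem_Iic⟩ x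
  obtain ⟨Ψ, hΨ⟩ := exists_factor (A k).mulVecLin ((B k).mulVecLin ∘ₗ Φ.1.toLinearMap)
    fun x hx => (hker x).2 hx
  have hΨ' : ∀ x, Ψ (A k *ᵥ x) = B k *ᵥ Φ.1 x := hΨ
  obtain ⟨Φ', h1, h2⟩ := exists_flag_equiv (A.kerFlag_antitone k.castSucc)
    (B.kerFlag_antitone k.castSucc) rfl (Rep.finrank_kerFlag_eq h k.castSucc)
    (LinearMap.range (A k).mulVecLin) Ψ
    (by
      rintro _ ⟨x, rfl⟩ hx
      exact (hker x).1 ((hΨ' x).symm.trans hx))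
    (by
      rintro i _ ⟨x, rfl⟩
      rw [Rep.mem_kerFlag, Rep.mem_kerFlag, hΨ, Matrix.mulVecLin_apply]
      exact hflag i x)
  exact ⟨⟨Φ', h2⟩, fun x => (h1 _ ⟨x, rfl⟩).trans (hΨ' x)⟩

/-- Representations of the equioriented quiver of type `A` are classified by the ranks of the
composite maps. -/
theorem mem_glOrbit_of_rank_eq {A B : Rep K d}
    (h : ∀ i j, i ≤ j → (A.comp i j).rank = (B.comp i j).rank) : B ∈ glOrbit A := by
  obtain ⟨Φ₀, -, hΦ₀⟩ := exists_flag_equiv (A.kerFlag_antitone (Fin.last n))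
    (B.kerFlag_antitone (Fin.last n)) rfl (Rep.finrank_kerFlag_eq h (Fin.last n)) ⊥ 0
    (by simp) (by simp)
  choose step hstep using FlagIso.exists_step h
  let Φ : ∀ l, FlagIso A B l := fun l =>
    Fin.reverseInduction (motive := FlagIso A B) ⟨Φ₀, hΦ₀⟩ step l
  have hΦ : ∀ (k : Fin n) x, (Φ k.castSucc).1 (A k *ᵥ x) = B k *ᵥ (Φ k.succ).1 x := by
    intro k x
    simp only [Φ, Fin.reverseInduction_castSucc]
    exact hstep k _ x
  let g : ∀ l, GL (Fin (d l)) K := fun l =>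
    ⟨LinearMap.toMatrix' (Φ l).1.toLinearMap, LinearMap.toMatrix' (Φ l).1.symm.toLinearMap,
      by rw [← LinearMap.toMatrix'_comp]; simp, by rw [← LinearMap.toMatrix'_comp]; simp⟩
  refine ⟨g, funext fun k => ?_⟩
  have hcomm : (g k.castSucc).1 * A k = B k * (g k.succ).1 := by
    refine Matrix.ext_of_mulVec_single fun b => ?_
    simp only [← Matrix.mulVec_mulVec]
    simp only [g, LinearMap.toMatrix'_mulVec]
    exact hΦ k _
  change (g k.castSucc).1 * A k * _ = _
  rw [hcomm, Matrix.mul_assoc, Units.mul_inv, Matrix.mul_one]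

/-! ### Irreducibility of the rank loci -/

theorem minRank_of_mem_setJ {i j : Fin (n + 1)} (hJ : (i, j) ∈ setJ d) (h : d i ≤ d j) :
    minRank d i j = d i := by
  refine le_antisymm (minRank_le le_rfl hJ.1.le) ((le_minRank_iff hJ.1.le).2 fun l hil hlj => ?_)
  rcases eq_or_lt_of_le hil with rfl | hil
  · exact le_rfl
  rcases eq_or_lt_of_le hlj with rfl | hlj
  · exact h
  exact (le_max_left _ _).trans (hJ.2 l hil hlj).le

theorem mem_rankLocus_iff_exists_vecMul {i j : Fin (n + 1)} (hJ : (i, j) ∈ setJ d) (h : d i ≤ d j)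
    {A : Rep K d} : A ∈ rankLocus K d (i, j) ↔ ∃ w ≠ 0, w ᵥ* A.comp i j = 0 := by
  rw [← rank_lt_iff_exists_vecMul_eq_zero, rankLocus, Set.mem_ofPred_eq,
    minRank_of_mem_setJ hJ h]

theorem rankLocus_nonempty (hd : ∀ i, 0 < d i) {i j : Fin (n + 1)} (hij : i < j) :
    (rankLocus K d (i, j)).Nonempty := by
  obtain ⟨A, hA⟩ : ∃ A : Rep K d, ∀ k, A k = 0 := ⟨fun _ => 0, fun _ => rfl⟩
  obtain ⟨k, rfl⟩ := Fin.exists_succ_eq.2 (Fin.ne_zero_of_lt hij)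
  refine ⟨A, ?_⟩
  change (A.comp i k.succ).rank < minRank d i k.succ
  rw [A.comp_succ _ _ (Fin.le_castSucc_iff.2 hij), hA, Matrix.mul_zero, Matrix.rank_zero]
  exact (le_minRank_iff hij.le).2 fun l _ _ => hd l

theorem exists_dotProduct_eq_one {m : Type*} [Fintype m] [DecidableEq m] {v : m → K} (hv : v ≠ 0) :
    ∃ u, v ⬝ᵥ u = 1 := by
  obtain ⟨a, ha⟩ := Function.ne_iff.1 hv
  exact ⟨Pi.single a (v a)⁻¹, by rw [dotProduct_single, mul_inv_cancel₀ ha]⟩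

/-- The representations with a covector at the vertex `i` that is killed by the map from `j` to
`i`, but by none of the maps from the vertices `l < j` with `l < N`. -/
def killLocus (K : Type*) [Field K] (d : Fin (n + 1) → ℕ) (i j : Fin (n + 1)) (N : ℕ) :
    Set (Rep K d) :=
  {A | ∃ w : Fin (d i) → K, (∀ l, i ≤ l → l < j → (l : ℕ) < N → w ᵥ* A.comp i l ≠ 0) ∧
    w ᵥ* A.comp i j = 0}

theorem rankLocus_eq_killLocus {i j : Fin (n + 1)} (hJ : (i, j) ∈ setJ d) (h : d i ≤ d j) :
    rankLocus K d (i, j) = killLocus K d i j (i + 1) := by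
  ext A
  rw [mem_rankLocus_iff_exists_vecMul hJ h]
  refine exists_congr fun w => and_congr_left fun _ => ⟨fun hw l hil _ hli => ?_, fun hw => ?_⟩
  · obtain rfl : i = l := le_antisymm hil (Fin.le_def.2 (by omega))
    rwa [Rep.comp_self, Matrix.vecMul_one]
  · have := hw i le_rfl hJ.1 (Nat.lt_succ_self _)
    rwa [Rep.comp_self, Matrix.vecMul_one] at this

section Infinite

variable [Infinite K]

/-- If the covector dies at the vertex `N`, it can be made to survive there by a deformation of the
single arrow from `N` to `N - 1`, as the map from `j` to `N` is not surjective. -/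
theorem killLocus_subset_closure {i j : Fin (n + 1)}
    (hd : ∀ l, i < l → l < j → d j < d l) {N : ℕ} (hN : (i : ℕ) < N) :
    killLocus K d i j N ⊆ closure (killLocus K d i j (N + 1)) := by
  rintro A ⟨w, hw, hwj⟩
  rcases le_or_gt (j : ℕ) N with hjN | hjN
  · exact subset_closure ⟨w, fun l hil hlj _ => hw l hil hlj (by omega), hwj⟩
  obtain ⟨k, hk⟩ : ∃ k : Fin n, (k.succ : ℕ) = N :=
    ⟨⟨N - 1, by omega⟩, by rw [Fin.val_succ]; simp only; omega⟩
  have hks : (k : ℕ) + 1 = N := by rw [← hk, Fin.val_succ]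
  have hik : i ≤ k.castSucc := Fin.le_def.2 (by rw [Fin.val_castSucc]; omega)
  have hkj : k.succ < j := Fin.lt_def.2 (by omega)
  have hkj' : k.castSucc < j := Fin.castSucc_lt_succ.trans hkj
  by_cases hv : w ᵥ* A.comp i k.succ = 0
  swap
  · refine subset_closure ⟨w, fun l hil hlj hlN => ?_, hwj⟩
    rcases Nat.lt_succ_iff_lt_or_eq.1 hlN with h | h
    · exact hw l hil hlj h
    · obtain rfl : l = k.succ := Fin.ext (h.trans hk.symm)
      exact hv
  obtain ⟨u, hu⟩ := exists_dotProduct_eq_one (hw k.castSucc hik hkj' (by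
    rw [Fin.val_castSucc]; omega))
  obtain ⟨x, hx0, hx⟩ := (rank_lt_iff_exists_vecMul_eq_zero (A.comp k.succ j)).1
    ((Matrix.rank_le_width _).trans_lt (hd k.succ (hik.trans_lt Fin.castSucc_lt_succ) hkj))
  let φ : K → Rep K d := fun s => Function.update A k (A k + s • Matrix.vecMulVec u x)
  have hφk : ∀ s, φ s k = A k + s • Matrix.vecMulVec u x := fun s => Function.update_self _ _ _
  have hφ' : ∀ s k', k' ≠ k → φ s k' = A k' := fun s k' h => Function.update_of_ne h _ _
  have hφ0 : φ 0 = A := by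
    funext k'
    rcases eq_or_ne k' k with rfl | h
    · rw [hφk, zero_smul, add_zero]
    · rw [hφ' _ _ h]
  have hpath : IsPolyPath φ := by
    intro k' a b
    rcases eq_or_ne k' k with rfl | h
    · simp only [hφk]
      exact (polyFun K).add_mem (const_mem_polyFun _)
        ((polyFun K).mul_mem id_mem_polyFun (const_mem_polyFun _))
    · simp only [hφ' _ _ h]
      exact const_mem_polyFun _
  have hlow : ∀ s l, i ≤ l → l ≤ k.castSucc → (φ s).comp i l = A.comp i l := fun s l hil hlk =>
    Rep.comp_congr hil fun k' _ hk' => hφ' s k' (by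
      rintro rfl
      exact absurd (hk'.trans hlk) (not_le.2 Fin.castSucc_lt_succ))
  have hmid : ∀ s, w ᵥ* (φ s).comp i k.succ = s • x := by
    intro s
    rw [Rep.comp_succ _ _ _ hik, hlow s _ hik le_rfl, hφk, Matrix.mul_add,
      ← Rep.comp_succ _ _ _ hik, Matrix.vecMul_add, hv, zero_add, ← Matrix.vecMul_vecMul,
      Matrix.vecMul_smul, Matrix.vecMul_vecMulVec, hu, one_smul]
  have hhigh : ∀ s, (φ s).comp k.succ j = A.comp k.succ j := fun s =>
    Rep.comp_congr hkj.le fun k' hk' _ => hφ' s k' (by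
      rintro rfl
      exact absurd hk' (not_le.2 Fin.castSucc_lt_succ))
  rw [← hφ0]
  refine hpath.mem_closure Polynomial.X Polynomial.X_ne_zero (fun s hs => ?_) 0
  rw [Polynomial.eval_X] at hs
  refine ⟨w, fun l hil hlj hlN => ?_, ?_⟩
  · rcases Nat.lt_succ_iff_lt_or_eq.1 hlN with h | h
    · rw [hlow s l hil (Fin.le_def.2 (by rw [Fin.val_castSucc]; omega))]
      exact hw l hil hlj h
    · obtain rfl : l = k.succ := Fin.ext (h.trans hk.symm)
      rw [hmid]
      exact smul_ne_zero hs hx0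
  · rw [Rep.comp_mul _ (hik.trans Fin.castSucc_lt_succ.le) hkj.le, ← Matrix.vecMul_vecMul, hmid,
      hhigh, Matrix.smul_vecMul, hx, smul_zero]

/-- The representations in which a covector at the vertex `i` survives up to the vertex `j - 1` and
dies at `j` are joined by polynomial paths: the linear path between two such representations can be
corrected so that it carries the linear paths between the images of the covectors into each other,
up to scalar factors. -/
theorem isPreirreducible_killLocus {i j : Fin (n + 1)} (hij : i < j) :
    IsPreirreducible (killLocus K d i j j) := by
  refine isPreirreducible_of_paths ?_
  rintro A ⟨w, hw, hwj⟩ B ⟨w', hw', hwj'⟩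
  -- the linear paths between the covectors, and between the representations
  let v : ∀ l, K → Fin (d l) → K := fun l s a => lin ((w ᵥ* A.comp i l) a) ((w' ᵥ* B.comp i l) a) s
  let L : K → Rep K d := fun s k => Matrix.of fun a b => lin (A k a b) (B k a b) s
  have hv0 : ∀ l, v l 0 = w ᵥ* A.comp i l := fun l => funext fun a => lin_zero _ _
  have hv1 : ∀ l, v l 1 = w' ᵥ* B.comp i l := fun l => funext fun a => lin_one _ _
  have hL0 : ∀ k, L 0 k = A k := fun k => by ext a b; simp [L]
  have hL1 : ∀ k, L 1 k = B k := fun k => by ext a b; simp [L]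
  have hvp : ∀ l a, (fun s => v l s a) ∈ polyFun K := fun l a => lin_mem_polyFun _ _
  have hLp : ∀ k a b, (fun s => L s k a b) ∈ polyFun K := fun k a b => lin_mem_polyFun _ _
  have hu : ∀ k : Fin n, ∃ u u' : Fin (d k.castSucc) → K, i ≤ k.castSucc → k.succ ≤ j →
      v k.castSucc 0 ⬝ᵥ u = 1 ∧ v k.castSucc 1 ⬝ᵥ u' = 1 := by
    intro k
    by_cases h : i ≤ k.castSucc ∧ k.succ ≤ j
    · have hlt : k.castSucc < j := Fin.castSucc_lt_succ.trans_le h.2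
      obtain ⟨u, hu⟩ := exists_dotProduct_eq_one (hw k.castSucc h.1 hlt hlt)
      obtain ⟨u', hu'⟩ := exists_dotProduct_eq_one (hw' k.castSucc h.1 hlt hlt)
      exact ⟨u, u', fun _ _ => ⟨by rw [hv0, hu], by rw [hv1, hu']⟩⟩
    · exact ⟨0, 0, fun h1 h2 => absurd ⟨h1, h2⟩ h⟩
  choose u u' huu using hu
  let U : ∀ k : Fin n, K → Fin (d k.castSucc) → K := fun k s a => lin (u k a) (u' k a) s
  have hU0 : ∀ k, U k 0 = u k := fun k => funext fun a => lin_zero _ _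
  have hU1 : ∀ k, U k 1 = u' k := fun k => funext fun a => lin_one _ _
  have hUp : ∀ k a, (fun s => U k s a) ∈ polyFun K := fun k a => lin_mem_polyFun _ _
  let c : Fin n → K → K := fun k s => v k.castSucc s ⬝ᵥ U k s
  have hcp : ∀ k, c k ∈ polyFun K := fun k => by
    have : c k = ∑ a, (fun s => v k.castSucc s a) * fun s => U k s a := by
      funext s
      rw [Finset.sum_apply]
      rfl
    rw [this]
    exact Subalgebra.sum_mem _ fun a _ => Subalgebra.mul_mem _ (hvp _ _) (hUp _ _)
  let e : ∀ k : Fin n, K → Fin (d k.succ) → K := fun k s => v k.succ s - v k.castSucc s ᵥ* L s k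
  have hep : ∀ k b, (fun s => e k s b) ∈ polyFun K := fun k b => by
    have : (fun s => e k s b) = (fun s => v k.succ s b) -
        ∑ a, (fun s => v k.castSucc s a) * fun s => L s k a b := by
      funext s
      rw [Pi.sub_apply, Finset.sum_apply]
      rfl
    rw [this]
    exact Subalgebra.sub_mem _ (hvp _ _)
      (Subalgebra.sum_mem _ fun a _ => Subalgebra.mul_mem _ (hvp _ _) (hLp _ _ _))
  -- `e k` is the error of the linear path at the arrow `k`; it is `0`, and `c k` is `1`, at both ends
  let φ : K → Rep K d := fun s k =>
    if i ≤ k.castSucc ∧ k.succ ≤ j then c k s • L s k + Matrix.vecMulVec (U k s) (e k s) else L s k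
  have hφ : ∀ s (k : Fin n), i ≤ k.castSucc → k.succ ≤ j →
      φ s k = c k s • L s k + Matrix.vecMulVec (U k s) (e k s) := fun s k h1 h2 => if_pos ⟨h1, h2⟩
  have hφ' : ∀ s k, ¬ (i ≤ k.castSucc ∧ k.succ ≤ j) → φ s k = L s k := fun s k h => if_neg h
  have hpath : IsPolyPath φ := by
    intro k a b
    by_cases h : i ≤ k.castSucc ∧ k.succ ≤ j
    · simp only [hφ _ k h.1 h.2]
      exact (polyFun K).add_mem ((polyFun K).mul_mem (hcp k) (hLp k a b))
        ((polyFun K).mul_mem (hUp k a) (hep k b))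
    · simp only [hφ' _ k h]
      exact hLp k a b
  have h0 : φ 0 = A := by
    funext k
    by_cases h : i ≤ k.castSucc ∧ k.succ ≤ j
    · have he : Matrix.vecMulVec (U k 0) (e k 0) = 0 := by
        simp only [e, hv0, hL0, Matrix.vecMul_vecMul, ← Rep.comp_succ _ _ _ h.1, sub_self]
        ext a b
        exact mul_zero _
      have hc : c k 0 = 1 := by simp only [c, hU0]; exact (huu k h.1 h.2).1
      rw [hφ _ k h.1 h.2, he, hc, hL0, one_smul, add_zero]
    · rw [hφ' _ k h, hL0]
  have h1 : φ 1 = B := by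
    funext k
    by_cases h : i ≤ k.castSucc ∧ k.succ ≤ j
    · have he : Matrix.vecMulVec (U k 1) (e k 1) = 0 := by
        simp only [e, hv1, hL1, Matrix.vecMul_vecMul, ← Rep.comp_succ _ _ _ h.1, sub_self]
        ext a b
        exact mul_zero _
      have hc : c k 1 = 1 := by simp only [c, hU1]; exact (huu k h.1 h.2).2
      rw [hφ _ k h.1 h.2, he, hc, hL1, one_smul, add_zero]
    · rw [hφ' _ k h, hL1]
  have hp : ∀ k : Fin n, ∃ p : K[X], p ≠ 0 ∧ (i ≤ k.castSucc → k.succ ≤ j →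
      ∀ s, p.eval s ≠ 0 → c k s ≠ 0) := by
    intro k
    by_cases h : i ≤ k.castSucc ∧ k.succ ≤ j
    · obtain ⟨p, hp⟩ := mem_polyFun_iff.1 (hcp k)
      refine ⟨p, ?_, fun _ _ s hs => by rwa [hp]⟩
      rintro rfl
      have hc : c k 0 = 1 := by simp only [c, hU0]; exact (huu k h.1 h.2).1
      rw [hp, Polynomial.eval_zero] at hc
      exact zero_ne_one hc
    · exact ⟨1, one_ne_zero, fun h1 h2 => absurd ⟨h1, h2⟩ h⟩
  choose p hp0 hp using hp
  refine ⟨φ, hpath, h0, h1, ∏ k, p k, Finset.prod_ne_zero_iff.2 fun k _ => hp0 k, fun s hs => ?_⟩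
  have hcs : ∀ k : Fin n, i ≤ k.castSucc → k.succ ≤ j → c k s ≠ 0 := fun k h1 h2 => by
    rw [Polynomial.eval_prod, Finset.prod_ne_zero_iff] at hs
    exact hp k h1 h2 s (hs k (Finset.mem_univ k))
  have hprop : ∀ l, i ≤ l → l ≤ j → ∃ C : K, C ≠ 0 ∧ v i s ᵥ* (φ s).comp i l = C • v l s := by
    intro l hil
    induction l, hil using le_succ_induction with
    | self => exact fun _ => ⟨1, one_ne_zero, by rw [Rep.comp_self, Matrix.vecMul_one, one_smul]⟩
    | succ k hk ih =>
      intro hkj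
      obtain ⟨C, hC, hC'⟩ := ih (Fin.castSucc_lt_succ.le.trans hkj)
      refine ⟨C * c k s, mul_ne_zero hC (hcs k hk hkj), ?_⟩
      rw [Rep.comp_succ _ _ _ hk, ← Matrix.vecMul_vecMul, hC', hφ s k hk hkj, Matrix.smul_vecMul,
        Matrix.vecMul_add, Matrix.vecMul_smul, Matrix.vecMul_vecMulVec, mul_smul, ← smul_add]
      simp only [e, c, add_sub_cancel]
  refine ⟨v i s, fun l hil hlj _ => ?_, ?_⟩
  · obtain ⟨C, hC, hC'⟩ := hprop l hil hlj.le
    rw [hC']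
    refine smul_ne_zero hC fun hzero => ?_
    obtain ⟨k, rfl⟩ := Fin.exists_castSucc_eq.2 (Fin.ne_last_of_lt hlj)
    have := hcs k hil (Fin.castSucc_lt_iff_succ_le.1 hlj)
    exact this (by simp only [c, hzero, zero_dotProduct])
  · obtain ⟨C, hC, hC'⟩ := hprop j hij.le le_rfl
    have hvj : v j s = 0 := funext fun a => by simp [v, hwj, hwj', lin]
    rw [hC', hvj, smul_zero]

theorem isIrreducible_rankLocus_of_le (hd : ∀ i, 0 < d i) {i j : Fin (n + 1)}
    (hJ : (i, j) ∈ setJ d) (h : d i ≤ d j) : IsIrreducible (rankLocus K d (i, j)) := by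
  have hij : i < j := hJ.1
  refine ⟨rankLocus_nonempty hd hij, ?_⟩
  have hd' : ∀ l, i < l → l < j → d j < d l := fun l hil hlj =>
    (le_max_right _ _).trans_lt (hJ.2 l hil hlj)
  have hsub : ∀ N : ℕ, (i : ℕ) + 1 ≤ N → rankLocus K d (i, j) ⊆ closure (killLocus K d i j N) := by
    intro N hN
    induction N, hN using Nat.le_induction with
    | base => rw [rankLocus_eq_killLocus hJ h]; exact subset_closure
    | succ N hN ih => exact ih.trans (closure_minimal (killLocus_subset_closure hd' hN)
        isClosed_closure)
  have hmono : killLocus K d i j j ⊆ rankLocus K d (i, j) := by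
    rw [rankLocus_eq_killLocus hJ h]
    exact fun A ⟨w, hw, hwj⟩ => ⟨w, fun l hil hlj _ => hw l hil hlj hlj, hwj⟩
  have : rankLocus K d (i, j) = closure (killLocus K d i j j) :=
    (hsub j (Fin.lt_def.1 hij)).antisymm (closure_minimal hmono (isClosed_rankLocus hij.le))
  rw [this]
  exact (isPreirreducible_killLocus hij).closure

end Infinite

/-! ### The height of the ideal of a graph -/

theorem height_eq_card_of_isMaximal {L : Type*} [Field L] {ι : Type*} [Finite ι]
    (M : Ideal (MvPolynomial ι L)) (hM : M.IsMaximal) : M.height = Nat.card ι := by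
  induction ι using Finite.induction_empty_option with
  | of_equiv e ih =>
    have h := ih (M.comap (MvPolynomial.renameEquiv L e).toRingEquiv)
      (Ideal.comap_isMaximal_of_equiv _)
    rwa [RingEquiv.height_comap, Nat.card_congr e] at h
  | h_empty =>
    have hbij : Function.Bijective (MvPolynomial.C : L → MvPolynomial PEmpty L) :=
      ⟨MvPolynomial.C_injective _ _, MvPolynomial.C_surjective _⟩
    have hf : IsField (MvPolynomial PEmpty L) :=
      (RingEquiv.ofBijective (MvPolynomial.C : L →+* MvPolynomial PEmpty L) hbij).symm.toMulEquiv.isField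
        (Field.toIsField L)
    let := hf.toField
    rw [(Ideal.eq_bot_or_top M).resolve_right hM.ne_top]
    simp
  | @h_option ι _ ih =>
    let e := (MvPolynomial.optionEquivLeft L ι).toRingEquiv
    let N : Ideal (Polynomial (MvPolynomial ι L)) := M.comap e.symm
    have hN : N.IsMaximal := Ideal.comap_isMaximal_of_equiv _
    have hcomap : (N.comap (Polynomial.C : MvPolynomial ι L →+* _)).IsMaximal :=
      Polynomial.isMaximal_comap_C_of_isJacobsonRing N
    have : N.LiesOver (N.comap (Polynomial.C : MvPolynomial ι L →+* _)) := ⟨rfl⟩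
    have h := Polynomial.height_eq_height_add_one (N.comap (Polynomial.C : MvPolynomial ι L →+* _)) N
    rw [ih _ hcomap] at h
    rw [← RingEquiv.height_comap e.symm, show M.comap e.symm = N from rfl, h]
    have : Fintype ι := Fintype.ofFinite ι
    simp [Nat.card_eq_fintype_card]

theorem isMaximal_of_linear {L : Type*} [Field L] {ι : Type*} (P : Ideal (MvPolynomial ι L))
    [hP : P.IsPrime] (h : ∀ t, ∃ x : L, MvPolynomial.X t - MvPolynomial.C x ∈ P) : P.IsMaximal := by
  have hsurj : ∀ p : MvPolynomial ι L, ∃ x : L, p - MvPolynomial.C x ∈ P := by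
    intro p
    induction p using MvPolynomial.induction_on with
    | C a => exact ⟨a, by rw [sub_self]; exact P.zero_mem⟩
    | add p q hp hq =>
      obtain ⟨x, hx⟩ := hp
      obtain ⟨y, hy⟩ := hq
      refine ⟨x + y, ?_⟩
      rw [MvPolynomial.C_add, add_sub_add_comm]
      exact P.add_mem hx hy
    | mul_X p t hp =>
      obtain ⟨x, hx⟩ := hp
      obtain ⟨y, hy⟩ := h t
      refine ⟨x * y, ?_⟩
      rw [MvPolynomial.C_mul, show p * MvPolynomial.X t - MvPolynomial.C x * MvPolynomial.C y =
        MvPolynomial.X t * (p - MvPolynomial.C x) +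
          MvPolynomial.C x * (MvPolynomial.X t - MvPolynomial.C y) by ring]
      exact P.add_mem (P.mul_mem_left _ hx) (P.mul_mem_left _ hy)
  refine Ideal.isMaximal_iff.2 ⟨fun h => hP.ne_top ((Ideal.eq_top_iff_one P).2 h), ?_⟩
  intro J p hPJ hp hpJ
  obtain ⟨x, hx⟩ := hsurj p
  have hx0 : x ≠ 0 := by
    rintro rfl
    rw [map_zero, sub_zero] at hx
    exact hp hx
  have hCx : MvPolynomial.C x ∈ J := by
    have := J.sub_mem hpJ (hPJ hx)
    rwa [sub_sub_cancel] at this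
  have := J.mul_mem_left (MvPolynomial.C x⁻¹) hCx
  rwa [← MvPolynomial.C_mul, inv_mul_cancel₀ hx0, MvPolynomial.C_1] at this

/-- A prime ideal `P` of `R[y_t]` that meets `R` only in `0` and contains polynomials
`u y_t + g_t` with `u`, `g_t` in `R` has height the number of variables: after inverting the nonzero
elements of `R` it is the maximal ideal of a rational point. -/
theorem height_eq_card_of_linear {R : Type*} [CommRing R] [IsDomain R] {ι : Type*} [Finite ι]
    (P : Ideal (MvPolynomial ι R)) [hP : P.IsPrime] (h0 : ∀ r : R, MvPolynomial.C r ∈ P → r = 0)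
    {u : R} (hu : u ≠ 0) (g : ι → R)
    (hg : ∀ t, MvPolynomial.C u * MvPolynomial.X t + MvPolynomial.C (g t) ∈ P) :
    P.height = Nat.card ι := by
  let L := FractionRing R
  let S := (nonZeroDivisors R).map (MvPolynomial.C (σ := ι) : R →+* _)
  let : Algebra (MvPolynomial ι R) (MvPolynomial ι L) := MvPolynomial.algebraMvPolynomial
  have : IsLocalization S (MvPolynomial ι L) := MvPolynomial.isLocalization _ L
  have hdisj : Disjoint (S : Set (MvPolynomial ι R)) (P : Set (MvPolynomial ι R)) := by
    rw [Set.disjoint_left]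
    rintro _ ⟨r, hr, rfl⟩ hrP
    exact nonZeroDivisors.ne_zero hr (h0 r hrP)
  rw [← IsLocalization.height_map_of_disjoint S (S := MvPolynomial ι L) P hdisj]
  have hprime : (P.map (algebraMap (MvPolynomial ι R) (MvPolynomial ι L))).IsPrime :=
    IsLocalization.isPrime_of_isPrime_disjoint S _ P hP hdisj
  refine height_eq_card_of_isMaximal _ (isMaximal_of_linear _ fun t => ?_)
  have hu' : algebraMap R L u ≠ 0 := (map_ne_zero_iff _ (IsFractionRing.injective R L)).2 hu
  refine ⟨-((algebraMap R L u)⁻¹ * algebraMap R L (g t)), ?_⟩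
  have hmem := Ideal.mul_mem_left _ (MvPolynomial.C (algebraMap R L u)⁻¹)
    (Ideal.mem_map_of_mem (algebraMap (MvPolynomial ι R) (MvPolynomial ι L)) (hg t))
  simp only [MvPolynomial.algebraMap_def, map_add, map_mul, MvPolynomial.map_C,
    MvPolynomial.map_X] at hmem
  rw [mul_add, ← mul_assoc, ← MvPolynomial.C_mul, ← MvPolynomial.C_mul, inv_mul_cancel₀ hu',
    MvPolynomial.C_1, one_mul] at hmem
  rw [map_neg, sub_neg_eq_add]
  exact hmem

/-- A prime ideal `P` of a polynomial ring such that, for a set `W` of variables, `P` contains no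
nonzero polynomial in the other variables, and contains polynomials `u y + g_y` for all `y` in `W`,
with `u` and `g_y` polynomials in the other variables, has height the number of elements of `W`. -/
theorem height_eq_card_of_graph {K : Type*} [Field K] {σ : Type*} [Finite σ] (W : σ → Prop)
    [DecidablePred W] (P : Ideal (MvPolynomial σ K)) [hP : P.IsPrime]
    (h0 : ∀ r : MvPolynomial {c // ¬ W c} K, MvPolynomial.rename Subtype.val r ∈ P → r = 0)
    {u : MvPolynomial {c // ¬ W c} K} (hu : u ≠ 0) (g : {c // W c} → MvPolynomial {c // ¬ W c} K)
    (hg : ∀ t : {c // W c}, MvPolynomial.rename Subtype.val u * MvPolynomial.X t.1 +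
      MvPolynomial.rename Subtype.val (g t) ∈ P) :
    P.height = Nat.card {c // W c} := by
  let e : MvPolynomial σ K ≃ₐ[K] MvPolynomial {c // W c} (MvPolynomial {c // ¬ W c} K) :=
    (MvPolynomial.renameEquiv K (Equiv.sumCompl W).symm).trans (MvPolynomial.sumAlgEquiv K _ _)
  have heC : ∀ r, e.symm (MvPolynomial.C r) = MvPolynomial.rename Subtype.val r := by
    intro r
    rw [AlgEquiv.symm_apply_eq]
    induction r using MvPolynomial.induction_on with
    | C a => simp [e]
    | add p q hp hq => simp only [map_add, hp, hq]
    | mul_X p t hp =>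
      rw [map_mul, map_mul, map_mul, hp]
      congr 1
      simp [e, t.2]
  have heX : ∀ t : {c // W c}, e.symm (MvPolynomial.X t) = MvPolynomial.X t.1 := by
    intro t
    rw [AlgEquiv.symm_apply_eq]
    simp [e, t.2]
  have hprime : (P.comap e.symm.toRingEquiv).IsPrime := Ideal.comap_isPrime _ _
  rw [← RingEquiv.height_comap e.symm.toRingEquiv]
  refine height_eq_card_of_linear _ (fun r hr => h0 r ?_) hu g fun t => ?_
  · rw [← heC]; exact hr
  · have := hg t
    rw [← heC, ← heC, ← heX, ← map_mul, ← map_add] at this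
    exact this

/-! ### Chains of vectors and covectors -/

theorem Rep.comp_mulVec_chain {A : Rep K d} {i j : Fin (n + 1)} (hij : i ≤ j)
    {x : ∀ l, Fin (d l) → K} (h : ∀ k : Fin n, i ≤ k.castSucc → k.succ ≤ j →
      A k *ᵥ x k.succ = x k.castSucc) : A.comp i j *ᵥ x j = x i := by
  induction j, hij using le_succ_induction with
  | self => rw [Rep.comp_self, Matrix.one_mulVec]
  | succ k hk ih =>
    rw [A.comp_succ _ _ hk, ← Matrix.mulVec_mulVec, h k hk le_rfl,
      ih fun l hl hl' => h l hl (hl'.trans Fin.castSucc_lt_succ.le)]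

theorem Rep.vecMul_comp_chain {A : Rep K d} {i j : Fin (n + 1)} (hij : i ≤ j)
    {x : ∀ l, Fin (d l) → K} (h : ∀ k : Fin n, i ≤ k.castSucc → k.succ ≤ j →
      x k.castSucc ᵥ* A k = x k.succ) : x i ᵥ* A.comp i j = x j := by
  induction j, hij using le_succ_induction with
  | self => rw [Rep.comp_self, Matrix.vecMul_one]
  | succ k hk ih =>
    rw [A.comp_succ _ _ hk, ← Matrix.vecMul_vecMul,
      ih fun l hl hl' => h l hl (hl'.trans Fin.castSucc_lt_succ.le), h k hk le_rfl]

/-- The standard basis vector of `K ^ m` with index `b`; it is zero if `b` is out of range. -/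
def evec (K : Type*) [Field K] (m b : ℕ) : Fin m → K := fun a => if (a : ℕ) = b then 1 else 0

theorem evec_val {m : ℕ} (b : Fin m) : evec K m b = Pi.single b 1 := by
  funext a
  simp [evec, Pi.single_apply, Fin.ext_iff]

theorem mulVec_evec {m p : ℕ} (B : Matrix (Fin m) (Fin p) K) (b : Fin p) (a : Fin m) :
    (B *ᵥ evec K p b) a = B a b := by
  rw [evec_val, Matrix.mulVec_single_one, Matrix.col_apply]

/-- The representation by partial identity matrices. -/
def stdRep (K : Type*) [Field K] (d : Fin (n + 1) → ℕ) : Rep K d := fun _ =>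
  Matrix.of fun a b => if (a : ℕ) = (b : ℕ) then 1 else 0

theorem stdRep_mulVec_evec (k : Fin n) {b : ℕ} (hb : b < d k.succ) :
    stdRep K d k *ᵥ evec K _ b = evec K _ b := by
  funext a
  exact mulVec_evec (stdRep K d k) ⟨b, hb⟩ a

theorem stdRep_comp_mulVec_evec {i j : Fin (n + 1)} (hij : i ≤ j) {b : ℕ}
    (hb : b < minRank d i j) : (stdRep K d).comp i j *ᵥ evec K _ b = evec K _ b :=
  Rep.comp_mulVec_chain (x := fun l => evec K (d l) b) hij fun k hik hkj =>
    stdRep_mulVec_evec k (hb.trans_le (minRank_le (hik.trans Fin.castSucc_lt_succ.le) hkj))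

theorem stdRep_comp_apply {i j : Fin (n + 1)} (hij : i ≤ j) (a : Fin (d i)) (b : Fin (d j))
    (hb : (b : ℕ) < minRank d i j) :
    (stdRep K d).comp i j a b = if (a : ℕ) = (b : ℕ) then 1 else 0 := by
  exact (mulVec_evec _ b a).symm.trans (congrFun (stdRep_comp_mulVec_evec hij hb) a)

/-! ### The codimension of the rank loci -/

theorem isPrime_vanishingIdeal {Z : Set (Rep K d)} (hZ : IsIrreducible Z) :
    (MvPolynomial.vanishingIdeal K (coords '' Z)).IsPrime := by
  have hmem : ∀ p : MvPolynomial (Coord d) K, p ∈ MvPolynomial.vanishingIdeal K (coords '' Z) ↔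
      Z ⊆ {A | MvPolynomial.eval (coords A) p = 0} := fun p => by
    rw [MvPolynomial.mem_vanishingIdeal_iff, Set.forall_mem_image]
    rfl
  have hclosed : ∀ p : MvPolynomial (Coord d) K,
      IsClosed {A : Rep K d | MvPolynomial.eval (coords A) p = 0} := fun p =>
    isClosed_zero (mem_regular_iff.2 ⟨p, fun _ => rfl⟩)
  refine ⟨fun h => ?_, fun {p q} hpq => ?_⟩
  · obtain ⟨A, hA⟩ := hZ.nonempty
    have := (hmem 1).1 (h ▸ Submodule.mem_top) hA
    simp at this
  · rw [hmem] at hpq ⊢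
    rw [hmem]
    refine isPreirreducible_iff_isClosed_union_isClosed.1 hZ.2 _ _ (hclosed p) (hclosed q) ?_
    intro A hA
    have := hpq hA
    rwa [Set.mem_ofPred_eq, map_mul, mul_eq_zero] at this

/-- A regular function that does not depend on the coordinates in `W` is a polynomial in the other
coordinates. -/
theorem exists_poly_of_indep (W : Coord d → Prop) {f : Rep K d → K} (hf : f ∈ regular K d)
    (hind : ∀ A A' : Rep K d, (∀ c, ¬ W c → coords A c = coords A' c) → f A = f A') :
    ∃ q : MvPolynomial {c // ¬ W c} K, ∀ A : Rep K d,
      MvPolynomial.eval (coords A) (MvPolynomial.rename Subtype.val q) = f A := by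
  classical
  obtain ⟨p, hp⟩ := mem_regular_iff.1 hf
  refine ⟨MvPolynomial.aeval (fun c => if h : W c then 0 else MvPolynomial.X ⟨c, h⟩) p,
    fun A => ?_⟩
  rw [hind A (ofCoords fun c => if W c then 0 else coords A c) fun c hc => by
    rw [coords_ofCoords, if_neg hc], hp, coords_ofCoords, MvPolynomial.eval_rename]
  have key : ∀ p : MvPolynomial (Coord d) K, MvPolynomial.eval (coords A ∘ Subtype.val)
      (MvPolynomial.aeval (fun c => if h : W c then 0 else
        (MvPolynomial.X ⟨c, h⟩ : MvPolynomial {c // ¬ W c} K)) p) =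
      MvPolynomial.eval (fun c => if W c then 0 else coords A c) p := by
    intro p
    induction p using MvPolynomial.induction_on with
    | C a => simp
    | add p q hp hq => simp only [map_add, hp, hq]
    | mul_X p c hp =>
      rw [map_mul, map_mul, map_mul, hp, MvPolynomial.aeval_X, MvPolynomial.eval_X]
      by_cases h : W c <;> simp [h]
  exact key p

/-- The row `r` of the adjugate of the square matrix of the first columns of `B`: a covector that
annihilates the columns of `B` with index less than `r`. -/
noncomputable def cofactorRow {m p : ℕ} (h : m ≤ p) (r : Fin m) (B : Matrix (Fin m) (Fin p) K) :
    Fin m → K := (B.submatrix id (Fin.castLE h)).adjugate r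

theorem cofactorRow_apply {m p : ℕ} (h : m ≤ p) (r : Fin m) (B : Matrix (Fin m) (Fin p) K)
    (a : Fin m) : cofactorRow h r B a =
      ((B.submatrix id (Fin.castLE h)).updateCol r (Pi.single a 1)).det := by
  rw [← Matrix.cramer_apply, Matrix.cramer_eq_adjugate_mulVec, Matrix.mulVec_single_one]
  rfl

theorem cofactorRow_congr {m p : ℕ} (h : m ≤ p) (r : Fin m) {B B' : Matrix (Fin m) (Fin p) K}
    (hB : ∀ a (b : Fin p), (b : ℕ) < m → (b : ℕ) ≠ r → B a b = B' a b) :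
    cofactorRow h r B = cofactorRow h r B' := by
  funext a
  rw [cofactorRow_apply, cofactorRow_apply]
  congr 1
  ext a' b
  rcases eq_or_ne b r with rfl | hb
  · rw [Matrix.updateCol_self, Matrix.updateCol_self]
  · rw [Matrix.updateCol_ne hb, Matrix.updateCol_ne hb]
    exact hB _ _ b.2 fun h => hb (Fin.ext h)

theorem cofactorRow_vecMul_of_lt {m p : ℕ} (h : m ≤ p) (r : Fin m) (B : Matrix (Fin m) (Fin p) K)
    (b : Fin p) (hb : (b : ℕ) < r) : (cofactorRow h r B ᵥ* B) b = 0 := by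
  have h1 := congrFun (congrFun (Matrix.adjugate_mul (B.submatrix id (Fin.castLE h))) r)
    ⟨b, hb.trans r.2⟩
  rw [Matrix.smul_apply, Matrix.one_apply_ne fun h => hb.ne' (congrArg Fin.val h), smul_zero] at h1
  exact h1

theorem cofactorRow_vecMul_of_rank_lt {m p : ℕ} (h : m ≤ p) (r : Fin m)
    (B : Matrix (Fin m) (Fin p) K) (hB : B.rank < m) : cofactorRow h r B ᵥ* B = 0 := by
  obtain ⟨w, hw, hw'⟩ := (rank_lt_iff_exists_vecMul_eq_zero B).1 hB
  funext b
  have h1 : (cofactorRow h r B ᵥ* B) b =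
      ((B.submatrix id (Fin.castLE h)).updateCol r (B.col b)).det := by
    rw [← Matrix.cramer_apply, Matrix.cramer_eq_adjugate_mulVec]
    rfl
  rw [h1]
  refine Matrix.exists_vecMul_eq_zero_iff.1 ⟨w, hw, funext fun c => ?_⟩
  rcases eq_or_ne c r with rfl | hc
  · simp only [Matrix.vecMul, Matrix.updateCol_self, dotProduct]
    exact congrFun hw' b
  · simp only [Matrix.vecMul, Matrix.updateCol_ne hc, dotProduct]
    exact congrFun hw' _

section Infinite

variable [Infinite K]

/-- Let `r` be the last index at the vertex `i`.  With the cofactor row `w` of the first columns of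
`B = A_(i,j)` and `v = w A_(i,j-1)`, the rank condition on `B` says, wherever `v` has a nonzero
entry at `r`, that `v` annihilates the columns of the last arrow `A_(j-1,j)` with index at least
`r`.  These are linear equations for the entries of the row `r` of that arrow, with coefficients
that do not involve these entries; so the rank locus is generically a graph. -/
theorem codim_rankLocus_of_le (hd : ∀ i, 0 < d i) {i j : Fin (n + 1)}
    (hJ : (i, j) ∈ setJ d) (h : d i ≤ d j) :
    codim (rankLocus K d (i, j)) = ((d j - d i + 1 : ℕ) : ℕ∞) := by
  classical
  have hirr := isIrreducible_rankLocus_of_le (K := K) hd hJ h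
  have hprime := isPrime_vanishingIdeal hirr
  have hij : i < j := hJ.1
  have hmin := minRank_of_mem_setJ hJ h
  have hmem : ∀ A : Rep K d, A ∈ rankLocus K d (i, j) ↔ (A.comp i j).rank < d i := fun A => by
    rw [rankLocus, Set.mem_ofPred_eq, hmin]
  have hdi : ∀ l, i ≤ l → l ≤ j → d i ≤ d l := (le_minRank_iff hij.le).1 hmin.ge
  obtain ⟨k, rfl⟩ := Fin.exists_succ_eq.2 (Fin.ne_zero_of_lt hij)
  have hik : i ≤ k.castSucc := Fin.le_castSucc_iff.2 hij
  have hkk : k.castSucc ≤ k.succ := Fin.castSucc_lt_succ.le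
  let r : Fin (d i) := ⟨d i - 1, Nat.sub_lt (hd i) one_pos⟩
  let r' : Fin (d k.castSucc) := Fin.castLE (hdi _ hik hkk) r
  let W : Coord d → Prop := fun c => c.1 = k ∧ (c.2.1 : ℕ) = r ∧ (r : ℕ) ≤ c.2.2
  let w : Rep K d → Fin (d i) → K := fun A => cofactorRow h r (A.comp i k.succ)
  let v : Rep K d → Fin (d k.castSucc) → K := fun A => w A ᵥ* A.comp i k.castSucc
  let u : Rep K d → K := fun A => v A r'
  let g : Fin (d k.succ) → Rep K d → K := fun b A => ∑ a ∈ Finset.univ.erase r', v A a * A k a b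
  have hval : ∀ A b, (w A ᵥ* A.comp i k.succ) b = u A * A k r' b + g b A := by
    intro A b
    rw [A.comp_succ _ _ hik, ← Matrix.vecMul_vecMul]
    exact (Finset.add_sum_erase Finset.univ (fun a => v A a * A k a b) (Finset.mem_univ r')).symm
  -- regularity of the coefficients
  have hwreg : ∀ a, (fun A => w A a) ∈ regular K d := by
    intro a
    simp only [w, cofactorRow_apply]
    refine det_mem fun a' b => ?_
    rcases eq_or_ne b r with rfl | hb
    · simp only [Matrix.updateCol_self]
      exact const_mem_regular _
    · simp only [Matrix.updateCol_ne hb]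
      exact comp_entry_mem_regular hij.le _ _
  have hvreg : ∀ a, (fun A => v A a) ∈ regular K d := by
    intro a
    have : (fun A => v A a) =
        ∑ c, (fun A => w A c) * fun A : Rep K d => A.comp i k.castSucc c a := by
      funext A
      rw [Finset.sum_apply]
      rfl
    rw [this]
    exact Subalgebra.sum_mem _ fun c _ =>
      Subalgebra.mul_mem _ (hwreg c) (comp_entry_mem_regular hik _ _)
  have hgreg : ∀ b, g b ∈ regular K d := by
    intro b
    have : g b = ∑ a ∈ Finset.univ.erase r', (fun A => v A a) * fun A : Rep K d => A k a b := by
      funext A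
      rw [Finset.sum_apply]
      rfl
    rw [this]
    exact Subalgebra.sum_mem _ fun a _ => Subalgebra.mul_mem _ (hvreg a) (entry_mem_regular _ _ _)
  -- independence of the coefficients from the entries in `W`
  have hvind : ∀ A A' : Rep K d, (∀ c, ¬ W c → coords A c = coords A' c) → v A = v A' := by
    intro A A' hAA'
    have h1 : A.comp i k.castSucc = A'.comp i k.castSucc :=
      Rep.comp_congr hik fun k' _ hk' => by
        ext a b
        refine hAA' ⟨k', a, b⟩ fun hW => ?_
        obtain rfl : k' = k := hW.1
        exact absurd hk' (not_le.2 Fin.castSucc_lt_succ)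
    have h2 : w A = w A' := by
      refine cofactorRow_congr h r fun a b hb hbr => ?_
      rw [Rep.comp_succ _ _ _ hik, Rep.comp_succ _ _ _ hik, h1, Matrix.mul_apply, Matrix.mul_apply]
      refine Finset.sum_congr rfl fun c _ => congrArg _ (hAA' ⟨k, c, b⟩ fun hW => ?_)
      have h3 : d i - 1 ≤ (b : ℕ) := hW.2.2
      have h4 : (b : ℕ) ≠ d i - 1 := hbr
      omega
    simp only [v, h1, h2]
  have hgind : ∀ b, ∀ A A' : Rep K d, (∀ c, ¬ W c → coords A c = coords A' c) →
      g b A = g b A' := by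
    intro b A A' hAA'
    simp only [g, hvind A A' hAA']
    refine Finset.sum_congr rfl fun a ha => congrArg _ (hAA' ⟨k, a, b⟩ fun hW => ?_)
    exact (Finset.mem_erase.1 ha).1 (Fin.ext hW.2.1)
  obtain ⟨qu, hqu⟩ := exists_poly_of_indep W (hvreg r') fun A A' hAA' => by rw [hvind A A' hAA']
  have hqu0 : qu ≠ 0 := by
    rintro rfl
    have h1 := hqu (stdRep K d)
    rw [map_zero, map_zero] at h1
    have h2 : ((stdRep K d).comp i k.succ).submatrix id (Fin.castLE h) = 1 := by
      ext a b
      rw [Matrix.submatrix_apply, stdRep_comp_apply hij.le _ _ (by rw [hmin]; exact b.2),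
        Matrix.one_apply]
      simp [Fin.ext_iff]
    have h3 : w (stdRep K d) = Pi.single r 1 := by
      simp only [w, cofactorRow, h2, Matrix.adjugate_one]
      funext a
      rw [Matrix.one_apply, Pi.single_apply]
      simp only [eq_comm]
    have h4 : v (stdRep K d) r' = 1 := by
      simp only [v, h3, Matrix.single_one_vecMul]
      refine (stdRep_comp_apply hik r r' ?_).trans (if_pos rfl)
      exact (show (r' : ℕ) < d i from r.2).trans_le ((le_minRank_iff hik).2 fun l hil hlk =>
        hdi l hil (hlk.trans hkk))
    rw [h4] at h1
    exact zero_ne_one h1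
  have hg : ∀ t : {c // W c}, ∃ q : MvPolynomial {c // ¬ W c} K,
      MvPolynomial.rename Subtype.val qu * MvPolynomial.X t.1 + MvPolynomial.rename Subtype.val q ∈
        MvPolynomial.vanishingIdeal K (coords '' rankLocus K d (i, k.succ)) := by
    rintro ⟨⟨k', a, b⟩, hk', ha, hb⟩
    obtain rfl : k' = k := hk'
    obtain rfl : a = r' := Fin.ext ha
    obtain ⟨q, hq⟩ := exists_poly_of_indep W (hgreg b) (hgind b)
    refine ⟨q, MvPolynomial.mem_vanishingIdeal_iff.2 ?_⟩
    rintro _ ⟨A, hA, rfl⟩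
    have h1 := congrFun (cofactorRow_vecMul_of_rank_lt h r _ ((hmem A).1 hA)) b
    change MvPolynomial.eval (coords A) _ = 0
    rw [map_add, map_mul, hqu, hq, MvPolynomial.eval_X]
    exact (hval A b).symm.trans h1
  choose q hq using hg
  have h0 : ∀ p : MvPolynomial {c // ¬ W c} K, MvPolynomial.rename Subtype.val p ∈
      MvPolynomial.vanishingIdeal K (coords '' rankLocus K d (i, k.succ)) → p = 0 := by
    intro p hp
    refine (mul_eq_zero.1 (?_ : p * qu = 0)).resolve_right hqu0
    refine MvPolynomial.funext fun x => ?_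
    rw [map_mul, map_zero, mul_eq_zero, or_iff_not_imp_right]
    intro hx
    -- solve the linear equations for the entries in `W`, the other entries being given by `x`
    let A₀ : Rep K d := ofCoords fun c => if hc : W c then 0 else x ⟨c, hc⟩
    let y : Fin (d k.succ) → K := fun b => -((u A₀)⁻¹ * g b A₀)
    let A : Rep K d := Function.update A₀ k
      ((A₀ k).updateRow r' fun b => if (r : ℕ) ≤ b then y b else A₀ k r' b)
    have hAk : A k = (A₀ k).updateRow r' fun b => if (r : ℕ) ≤ b then y b else A₀ k r' b :=
      Function.update_self _ _ _
    have hAA₀ : ∀ c, ¬ W c → coords A c = coords A₀ c := by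
      rintro ⟨k', a, b⟩ hc
      simp only [coords]
      rcases eq_or_ne k' k with rfl | hk'
      · rw [hAk]
        rcases eq_or_ne a r' with rfl | ha
        · rw [Matrix.updateRow_self, if_neg fun hb => hc ⟨rfl, rfl, hb⟩]
        · rw [Matrix.updateRow_ne ha]
      · exact congrFun (congrFun (Function.update_of_ne hk' _ _ : A k' = A₀ k') a) b
    have hx₀ : ∀ B : Rep K d, (∀ c, ¬ W c → coords B c = coords A₀ c) →
        ∀ p : MvPolynomial {c // ¬ W c} K,
          MvPolynomial.eval (coords B) (MvPolynomial.rename Subtype.val p) =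
            MvPolynomial.eval x p := by
      intro B hB p
      rw [MvPolynomial.eval_rename]
      congr 2
      funext c
      rw [Function.comp_apply, hB c.1 c.2]
      simp only [A₀, coords_ofCoords, dif_neg c.2]
    have hu0 : u A₀ ≠ 0 := by
      simp only [u]
      rw [← hqu A₀, hx₀ A₀ fun _ _ => rfl]
      exact hx
    have huA : u A = u A₀ := congrFun (hvind A A₀ hAA₀) r'
    have hA : A ∈ rankLocus K d (i, k.succ) := by
      rw [hmem, rank_lt_iff_exists_vecMul_eq_zero]
      refine ⟨w A, fun hw => hu0 ?_, funext fun b => ?_⟩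
      · rw [← huA]
        simp only [u, v, hw, Matrix.zero_vecMul, Pi.zero_apply]
      · rcases lt_or_ge (b : ℕ) r with hb | hb
        · exact cofactorRow_vecMul_of_lt h r _ b hb
        · rw [hval, huA, hgind b A A₀ hAA₀, hAk, Matrix.updateRow_self, if_pos hb]
          simp only [y, mul_neg, Pi.zero_apply]
          rw [mul_inv_cancel_left₀ hu0, neg_add_cancel]
    have := MvPolynomial.mem_vanishingIdeal_iff.1 hp _ ⟨A, hA, rfl⟩
    rw [← hx₀ A hAA₀ p]
    exact this
  rw [codim, height_eq_card_of_graph W _ h0 hqu0 q hq]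
  have hcard : Nat.card {c // W c} = d k.succ - d i + 1 := by
    have hlt : ∀ t : Fin (d k.succ - d i + 1), (r : ℕ) + t < d k.succ := fun t => by
      have h1 : (r : ℕ) = d i - 1 := rfl
      have := t.2
      have := hd i
      omega
    have hbij : Function.Bijective fun t : Fin (d k.succ - d i + 1) =>
        (⟨⟨k, r', ⟨r + t, hlt t⟩⟩, rfl, rfl, Nat.le_add_right _ _⟩ : {c // W c}) := by
      constructor
      · intro t t' htt'
        simp only [Subtype.mk.injEq, Sigma.mk.injEq, heq_eq_eq, Prod.mk.injEq, Fin.mk.injEq,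
          true_and] at htt'
        exact Fin.ext (by omega)
      · rintro ⟨⟨k', a, b⟩, hk', ha, hb⟩
        obtain rfl : k' = k := hk'
        obtain rfl : a = r' := Fin.ext ha
        have hb' : d i - 1 ≤ (b : ℕ) := hb
        refine ⟨⟨b - r, ?_⟩, ?_⟩
        · have h1 : (r : ℕ) = d i - 1 := rfl
          have := b.2
          have := hd i
          omega
        · refine Subtype.ext ?_
          simp only [Sigma.mk.injEq, heq_eq_eq, Prod.mk.injEq, true_and]
          exact Fin.ext (Nat.add_sub_cancel' hb)
    rw [← Nat.card_congr (Equiv.ofBijective _ hbij), Nat.card_eq_fintype_card, Fintype.card_fin]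
  rw [hcard]

end Infinite

/-! ### Duality -/

/-- The map of representation spaces induced by a bijection of the matrix entries. -/
def permuteCoords {K : Type*} {d d' : Fin (n + 1) → ℕ} (e : Coord d' ≃ Coord d) : Rep K d ≃ Rep K d' where
  toFun A := ofCoords (coords A ∘ e)
  invFun B := ofCoords (coords B ∘ e.symm)
  left_inv A := by simp [Function.comp_assoc]
  right_inv B := by simp [Function.comp_assoc]

theorem coords_permuteCoords {K : Type*} {d d' : Fin (n + 1) → ℕ} (e : Coord d' ≃ Coord d) (A : Rep K d) :
    coords (permuteCoords e A) = coords A ∘ e := rfl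

theorem continuous_permuteCoords {d d' : Fin (n + 1) → ℕ} (e : Coord d' ≃ Coord d) :
    Continuous (permuteCoords e : Rep K d → Rep K d') := by
  refine continuous_iff_isClosed.2 fun Z hZ => ?_
  obtain ⟨S, rfl⟩ := isClosed_iff.1 hZ
  refine isClosed_iff.2 ⟨MvPolynomial.rename e '' S, ?_⟩
  ext A
  simp [coords_permuteCoords, MvPolynomial.eval_rename]

theorem codim_image_permuteCoords {d d' : Fin (n + 1) → ℕ} (e : Coord d' ≃ Coord d)
    (Z : Set (Rep K d)) : codim (permuteCoords e '' Z) = codim Z := by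
  rw [codim, codim, ← RingEquiv.height_comap (MvPolynomial.renameEquiv K e).toRingEquiv
    (MvPolynomial.vanishingIdeal K (coords '' Z))]
  congr 1
  ext p
  change (∀ x ∈ _, _) ↔ (∀ x ∈ _, MvPolynomial.aeval x (MvPolynomial.rename e p) = 0)
  simp only [Set.forall_mem_image, coords_permuteCoords, MvPolynomial.aeval_rename]

/-- The bijection of the matrix entries given by transposing all matrices and reversing the order
of the vertices. -/
noncomputable def dualCoord (d : Fin (n + 1) → ℕ) : Coord (fun l => d l.rev) ≃ Coord d :=
  Equiv.ofBijective
    (fun c => ⟨c.1.rev, Fin.cast (congrArg d (Fin.rev_succ c.1)) c.2.2,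
      Fin.cast (congrArg d (Fin.rev_castSucc c.1)) c.2.1⟩) (by
    constructor
    · rintro ⟨k, a, b⟩ ⟨k', a', b'⟩ h
      obtain rfl : k = k' := Fin.rev_injective (congrArg Sigma.fst h)
      simpa [Sigma.mk.injEq, Prod.ext_iff, Fin.ext_iff, and_comm] using h
    · rintro ⟨m, a, b⟩
      obtain ⟨k, rfl⟩ : ∃ k : Fin n, m = k.rev := ⟨m.rev, m.rev_rev.symm⟩
      exact ⟨⟨k, Fin.cast (congrArg d (Fin.rev_castSucc k).symm) b,
        Fin.cast (congrArg d (Fin.rev_succ k).symm) a⟩, rfl⟩)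

/-- The dual representation: all matrices are transposed, and the order of the vertices is
reversed. -/
noncomputable def dual {K : Type*} : Rep K d ≃ Rep K (fun l => d l.rev) := permuteCoords (dualCoord d)

/-- A form of `Rep.comp_castSucc` for vertices that are only propositionally equal to the ends of
the arrow `m`. -/
theorem Rep.comp_eq_submatrix_mul (A : Rep K d) (m : Fin n) {a b c : Fin (n + 1)}
    (ha : a = m.castSucc) (hb : b = m.succ) (hbc : b ≤ c) :
    A.comp a c = (A m).submatrix (Fin.cast (congrArg d ha)) (Fin.cast (congrArg d hb)) *
      A.comp b c := by
  subst ha hb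
  exact A.comp_castSucc m hbc

theorem dual_comp (A : Rep K d) {i j : Fin (n + 1)} (hij : i ≤ j) :
    (dual A).comp i j = (A.comp j.rev i.rev)ᵀ := by
  induction j, hij using le_succ_induction with
  | self => rw [Rep.comp_self, Rep.comp_self, Matrix.transpose_one]
  | succ k hk ih =>
    rw [Rep.comp_succ _ _ _ hk, ih, A.comp_eq_submatrix_mul k.rev (Fin.rev_succ k)
      (Fin.rev_castSucc k) (Fin.rev_le_rev.2 hk), Matrix.transpose_mul]
    rfl

theorem minRank_dual (i j : Fin (n + 1)) :
    minRank (fun l => d l.rev) i j = minRank d j.rev i.rev := by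
  have : (fun l : Fin (n + 1) => d l.rev) '' Set.Icc i j = d '' Set.Icc j.rev i.rev := by
    ext m
    constructor
    · rintro ⟨l, hl, rfl⟩
      exact ⟨l.rev, ⟨Fin.rev_le_rev.2 hl.2, Fin.rev_le_rev.2 hl.1⟩, rfl⟩
    · rintro ⟨l, hl, rfl⟩
      exact ⟨l.rev, ⟨Fin.le_rev_iff.2 hl.2, Fin.rev_le_iff.2 hl.1⟩, congrArg d l.rev_rev⟩
  rw [minRank, minRank, this]

theorem dual_mem_rankLocus {A : Rep K d} {i j : Fin (n + 1)} (hij : i ≤ j) :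
    dual A ∈ rankLocus K (fun l => d l.rev) (j.rev, i.rev) ↔ A ∈ rankLocus K d (i, j) := by
  rw [rankLocus, Set.mem_ofPred_eq, dual_comp A (Fin.rev_le_rev.2 hij), Matrix.rank_transpose,
    minRank_dual, Fin.rev_rev, Fin.rev_rev]
  rfl

theorem rankLocus_eq_image {i j : Fin (n + 1)} (hij : i ≤ j) : rankLocus K d (i, j) =
    (permuteCoords (dualCoord d).symm) '' rankLocus K (fun l => d l.rev) (j.rev, i.rev) := by
  ext A
  constructor
  · exact fun hA => ⟨dual A, (dual_mem_rankLocus hij).2 hA, dual.symm_apply_apply A⟩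
  · rintro ⟨B, hB, rfl⟩
    refine (dual_mem_rankLocus hij).1 ?_
    rwa [show dual (permuteCoords (dualCoord d).symm B) = B from dual.apply_symm_apply B]

theorem mem_setJ_dual {i j : Fin (n + 1)} (hJ : (i, j) ∈ setJ d) :
    (j.rev, i.rev) ∈ setJ (fun l => d l.rev) := by
  refine ⟨Fin.rev_lt_rev.2 hJ.1, fun l hl hl' => ?_⟩
  simp only [Fin.rev_rev]
  rw [max_comm]
  exact hJ.2 l.rev (Fin.lt_rev_iff.2 hl') (Fin.rev_lt_iff.2 hl)

theorem mem_setI_dual {i j : Fin (n + 1)} (hI : (i, j) ∈ setI d) :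
    (j.rev, i.rev) ∈ setI (fun l => d l.rev) := by
  refine ⟨mem_setJ_dual hI.1, ?_⟩
  simp only [Fin.rev_rev]
  rcases hI.2 with h | ⟨h, h'⟩ | ⟨h, h'⟩
  · exact Or.inl h.symm
  · refine Or.inr (Or.inr ⟨h, fun l hl hm => h' l.rev (Fin.lt_rev_iff.2 hl) fun m hjm hml => ?_⟩)
    have := hm m.rev (Fin.le_rev_iff.2 hml) (Fin.rev_lt_rev.2 hjm)
    rwa [Fin.rev_rev] at this
  · refine Or.inr (Or.inl ⟨h, fun l hl hm => h' l.rev (Fin.rev_lt_iff.2 hl) fun m hjm hml => ?_⟩)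
    have := hm m.rev (Fin.rev_lt_rev.2 hml) (Fin.rev_le_iff.2 hjm)
    rwa [Fin.rev_rev] at this

section Infinite

variable [Infinite K]

theorem isIrreducible_rankLocus (hd : ∀ i, 0 < d i) {i j : Fin (n + 1)} (hJ : (i, j) ∈ setJ d) :
    IsIrreducible (rankLocus K d (i, j)) := by
  rcases le_or_gt (d i) (d j) with h | h
  · exact isIrreducible_rankLocus_of_le hd hJ h
  · rw [rankLocus_eq_image hJ.1.le]
    refine (isIrreducible_rankLocus_of_le (fun l => hd l.rev) (mem_setJ_dual hJ) ?_).image _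
      (continuous_permuteCoords _).continuousOn
    simpa only [Fin.rev_rev] using h.le

theorem codim_rankLocus (hd : ∀ i, 0 < d i) {i j : Fin (n + 1)} (hJ : (i, j) ∈ setJ d) :
    codim (rankLocus K d (i, j)) = (((d j : ℤ) - (d i : ℤ)).natAbs + 1 : ℕ) := by
  rcases le_or_gt (d i) (d j) with h | h
  · rw [codim_rankLocus_of_le hd hJ h]
    congr 2
    omega
  · rw [rankLocus_eq_image hJ.1.le, codim_image_permuteCoords,
      codim_rankLocus_of_le (fun l => hd l.rev) (mem_setJ_dual hJ)
        (by simpa only [Fin.rev_rev] using h.le)]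
    simp only [Fin.rev_rev]
    congr 2
    omega

end Infinite

/-! ### Test representations in the rank loci -/

theorem le_rank_of_mulVec_evec {m p N : ℕ} (B : Matrix (Fin m) (Fin p) K) (hN : N ≤ p) (f : ℕ → ℕ)
    (hf : ∀ b < N, f b < m) (hinj : ∀ b < N, ∀ b' < N, f b = f b' → b = b')
    (hB : ∀ b < N, B *ᵥ evec K p b = evec K m (f b)) : N ≤ B.rank := by
  have h1 : B.submatrix (fun a : Fin N => ⟨f a, hf a a.2⟩) (Fin.castLE hN) = 1 := by
    ext a b
    rw [Matrix.submatrix_apply, ← mulVec_evec B, Fin.val_castLE, hB b b.2, Matrix.one_apply]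
    exact if_congr ⟨fun h => Fin.ext (hinj _ a.2 _ b.2 h), fun h => h ▸ rfl⟩ rfl rfl
  calc N = (1 : Matrix (Fin N) (Fin N) K).rank := by rw [Matrix.rank_one, Fintype.card_fin]
    _ ≤ B.rank := h1 ▸ Matrix.rank_submatrix_le _ _ _

/-- All arrows are partial identity matrices, except that the arrow `k₀` sends the basis vector
with index `r` to the one with index `s`. -/
def modRep (K : Type*) [Field K] (d : Fin (n + 1) → ℕ) (k₀ : Fin n) (r s : ℕ) : Rep K d := fun k =>
  Matrix.of fun a b => if (a : ℕ) = (if k = k₀ ∧ (b : ℕ) = r then s else b) then 1 else 0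

theorem modRep_mulVec_evec {k₀ : Fin n} {r s : ℕ} (k : Fin n) {b : ℕ} (hb : b < d k.succ) :
    modRep K d k₀ r s k *ᵥ evec K _ b = evec K _ (if k = k₀ ∧ b = r then s else b) := by
  funext a
  exact mulVec_evec (modRep K d k₀ r s k) ⟨b, hb⟩ a

theorem evec_vecMul {m p : ℕ} (B : Matrix (Fin m) (Fin p) K) (a : Fin m) (b : Fin p) :
    (evec K m a ᵥ* B) b = B a b := by
  rw [evec_val, Matrix.single_one_vecMul, Matrix.row_apply]

theorem modRep_mem_rankLocus (hd : ∀ i, 0 < d i) {i : Fin (n + 1)} {k₀ : Fin n}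
    (hJ : (i, k₀.succ) ∈ setJ d) (h : d i ≤ d k₀.succ) :
    modRep K d k₀ (d i - 1) (d k₀.succ) ∈ rankLocus K d (i, k₀.succ) := by
  rw [mem_rankLocus_iff_exists_vecMul hJ h]
  have hlt : ∀ l, i ≤ l → l ≤ k₀.succ → d i - 1 < d l := fun l hil hlj =>
    (Nat.sub_lt (hd i) one_pos).trans_le
      ((le_minRank_iff hJ.1.le).1 (minRank_of_mem_setJ hJ h).ge l hil hlj)
  -- the covectors with index `d i - 1` are mapped to each other, up to the arrow `k₀`
  have hchain := Rep.vecMul_comp_chain (A := modRep K d k₀ (d i - 1) (d k₀.succ)) hJ.1.le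
    (x := fun l => if l < k₀.succ then evec K (d l) (d i - 1) else 0) fun k hik hkj => by
      have hk : k.castSucc < k₀.succ := Fin.castSucc_lt_succ.trans_le hkj
      have ha := hlt k.castSucc hik hk.le
      simp only [if_pos hk]
      funext b
      refine (evec_vecMul (modRep K d k₀ (d i - 1) (d k₀.succ) k) ⟨_, ha⟩ b).trans ?_
      change (if d i - 1 = (if k = k₀ ∧ (b : ℕ) = d i - 1 then d k₀.succ else b) then (1 : K)
        else 0) = _
      have hne : d i - 1 ≠ d k₀.succ := by have := hd i; omega
      rcases eq_or_lt_of_le hkj with hk' | hk'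
      · obtain rfl : k = k₀ := Fin.succ_injective _ hk'
        rw [if_neg (lt_irrefl _)]
        by_cases hb : (b : ℕ) = d i - 1
        · simp [hb, hne]
        · simp [hb, Ne.symm hb]
      · rw [if_pos hk', if_neg (c := k = k₀ ∧ (b : ℕ) = d i - 1) fun h =>
          hk'.ne (congrArg Fin.succ h.1)]
        exact if_congr eq_comm rfl rfl
  simp only [if_pos hJ.1, lt_irrefl, if_false] at hchain
  refine ⟨_, fun h0 => ?_, hchain⟩
  have := congrFun h0 ⟨d i - 1, Nat.sub_lt (hd i) one_pos⟩
  simp [evec] at this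

/-- The test representation for `(i, j)` lies only in the loci `Y_{s,t}` in which `Y_{i,j}` is
contained since `A_(s,t)` factors through `A_(i,j)`. -/
theorem of_modRep_mem_rankLocus {i : Fin (n + 1)} {k₀ : Fin n}
    (hJ : (i, k₀.succ) ∈ setJ d) (h : d i ≤ d k₀.succ) {s t : Fin (n + 1)} (hst : s < t)
    (hmem : modRep K d k₀ (d i - 1) (d k₀.succ) ∈ rankLocus K d (s, t)) :
    s ≤ i ∧ k₀.succ ≤ t ∧ d i ≤ minRank d s t := by
  have hrank : ((modRep K d k₀ (d i - 1) (d k₀.succ)).comp s t).rank < minRank d s t := hmem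
  have hmin : ∀ {b}, b < minRank d s t → ∀ l, s ≤ l → l ≤ t → b < d l := fun hb l hsl hlt =>
    hb.trans_le (minRank_le hsl hlt)
  -- the map from `t` to `s` has maximal rank if it is not affected by the modified entry
  have hstd : ∃ k : Fin n, s ≤ k.castSucc ∧ k.succ ≤ t ∧ k = k₀ ∧ d i ≤ minRank d s t := by
    by_contra! hno
    refine hrank.not_ge (le_rank_of_mulVec_evec _ (minRank_le hst.le le_rfl) id
      (fun b hb => hmin hb s le_rfl hst.le) (fun b _ b' _ h => h) fun b hb => ?_)
    refine Rep.comp_mulVec_chain (x := fun l => evec K (d l) b) hst.le fun k hsk hkt => ?_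
    have := modRep_mulVec_evec (K := K) (k₀ := k₀) (r := d i - 1) (s := d k₀.succ) k
      (hmin hb k.succ (hsk.trans Fin.castSucc_lt_succ.le) hkt)
    have hne : ¬ (k = k₀ ∧ b = d i - 1) := fun ⟨h1, h2⟩ => by
      have h3 := hno k hsk hkt h1
      omega
    rwa [if_neg hne] at this
  obtain ⟨k, hsk, hkt, rfl, hdi⟩ := hstd
  refine ⟨not_lt.1 fun his => ?_, hkt, hdi⟩
  -- if `s` lies between `i` and `j`, the modified entry does not decrease the rank either
  have hbig : ∀ l, s ≤ l → l < k.succ → d k.succ < d l := fun l hsl hlk =>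
    (le_max_right _ _).trans_lt (hJ.2 l (his.trans_le hsl) hlk)
  have hbj : ∀ {b}, b < minRank d s t → b < d k.succ := fun hb =>
    hmin hb k.succ (hsk.trans Fin.castSucc_lt_succ.le) hkt
  let f : ℕ → ℕ := fun b => if b = d i - 1 then d k.succ else b
  have hf : ∀ b < minRank d s t, ∀ l, s ≤ l → l < k.succ → f b < d l := by
    intro b hb l hsl hlk
    simp only [f]
    split_ifs
    · exact hbig l hsl hlk
    · exact hmin hb l hsl (hlk.le.trans hkt)
  have hsk' : s < k.succ := hsk.trans_lt Fin.castSucc_lt_succ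
  refine hrank.not_ge (le_rank_of_mulVec_evec _ (minRank_le hst.le le_rfl) f
    (fun b hb => hf b hb s le_rfl hsk') (fun b hb b' hb' hbb' => ?_) fun b hb => ?_)
  · have h1 := hbj hb
    have h2 := hbj hb'
    simp only [f] at hbb'
    split_ifs at hbb' <;> omega
  · have hchain := Rep.comp_mulVec_chain (A := modRep K d k (d i - 1) (d k.succ)) hst.le
      (x := fun l => evec K (d l) (if l < k.succ then f b else b)) fun k' hsk' hkt' => by
        rcases lt_trichotomy k' k with hlt | rfl | hgt
        · have h1 : k'.succ < k.succ := Fin.succ_lt_succ_iff.2 hlt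
          simp only [if_pos h1, if_pos (Fin.castSucc_lt_succ.trans h1)]
          rw [modRep_mulVec_evec k' (hf b hb _ (hsk'.trans Fin.castSucc_lt_succ.le) h1),
            if_neg fun h => hlt.ne h.1]
        · simp only [lt_irrefl, if_false, if_pos (Fin.castSucc_lt_succ (i := k'))]
          rw [modRep_mulVec_evec k' (hbj hb)]
          simp [f]
        · have h1 : ¬ k'.succ < k.succ := not_lt.2 (Fin.succ_le_succ_iff.2 hgt.le)
          have h2 : ¬ k'.castSucc < k.succ := not_lt.2 (Fin.succ_le_castSucc_iff.2 hgt)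
          simp only [if_neg h1, if_neg h2]
          rw [modRep_mulVec_evec k' (hmin hb _ (hsk'.trans Fin.castSucc_lt_succ.le) hkt'),
            if_neg fun h => hgt.ne' h.1]
    simpa only [if_pos hsk', if_neg (not_lt.2 hkt)] using hchain

theorem exists_mem_rankLocus_of_le (hd : ∀ i, 0 < d i) {i j : Fin (n + 1)} (hI : (i, j) ∈ setI d)
    (h : d i ≤ d j) : ∃ A ∈ rankLocus K d (i, j), ∀ q ∈ setJ d, A ∈ rankLocus K d q → q = (i, j) := by
  have hJ := hI.1
  obtain ⟨k, rfl⟩ := Fin.exists_succ_eq.2 (Fin.ne_zero_of_lt hJ.1)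
  refine ⟨_, modRep_mem_rankLocus hd hJ h, ?_⟩
  rintro ⟨s, t⟩ hq hmem
  obtain ⟨hsi, hjt, hmin⟩ := of_modRep_mem_rankLocus hJ h hq.1 hmem
  have hmin' := (le_minRank_iff hq.1.le).1 hmin
  have hst : s < t := hq.1
  have hij : i < k.succ := hJ.1
  have hsi' : s = i := by
    by_contra hne
    have h1 := hq.2 i (lt_of_le_of_ne hsi hne) (hij.trans_le hjt)
    have h2 := hmin' s le_rfl hst.le
    exact absurd ((le_max_left _ _).trans_lt h1) (not_lt.2 h2)
  have hjt' : t = k.succ := by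
    by_contra hne
    have hlt : k.succ < t := lt_of_le_of_ne hjt (Ne.symm hne)
    have h1 : d t < d k.succ := (le_max_right _ _).trans_lt (hq.2 k.succ (hsi.trans_lt hij) hlt)
    have h2 := hmin' t hst.le le_rfl
    rcases hI.2 with h3 | ⟨_, h3⟩ | ⟨h3, _⟩
    · have h3' : d i = d k.succ := h3
      omega
    · exact absurd (h3 t hlt fun m hm hmt => hmin' m ((hsi.trans hij.le).trans hm.le) hmt)
        (not_le.2 h1)
    · exact absurd h (not_le.2 h3)
  rw [hsi', hjt']

/-- The locus of a pair in `I(d)` is contained in no other locus of a pair in `J(d)`. -/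
theorem exists_mem_rankLocus (hd : ∀ i, 0 < d i) {p : Fin (n + 1) × Fin (n + 1)}
    (hI : p ∈ setI d) :
    ∃ A ∈ rankLocus K d p, ∀ q ∈ setJ d, A ∈ rankLocus K d q → q = p := by
  obtain ⟨i, j⟩ := p
  rcases le_or_gt (d i) (d j) with h | h
  · exact exists_mem_rankLocus_of_le hd hI h
  · obtain ⟨B, hB, hB'⟩ := exists_mem_rankLocus_of_le (K := K) (fun l => hd l.rev)
      (mem_setI_dual hI) (by simpa only [Fin.rev_rev] using h.le)
    obtain ⟨A, rfl⟩ := dual.surjective B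
    refine ⟨A, (dual_mem_rankLocus hI.1.1.le).1 hB, ?_⟩
    rintro ⟨s, t⟩ hq hmem
    have := hB' _ (mem_setJ_dual hq) ((dual_mem_rankLocus hq.1.le).2 hmem)
    rw [Prod.mk.injEq] at this
    rw [Fin.rev_injective this.1, Fin.rev_injective this.2]

/-! ### The decomposition of the complement of the generic orbit -/

theorem mem_complY_iff {A : Rep K d} :
    A ∈ complY K d ↔ ∃ i j, i < j ∧ (A.comp i j).rank < minRank d i j := by
  simp only [complY, genericOrbit, Set.mem_compl_iff, Set.mem_ofPred_eq, not_forall, exists_prop]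
  exact exists_congr fun i => exists_congr fun j => and_congr_right fun h =>
    ⟨fun hne => lt_of_le_of_ne (A.rank_comp_le h.le) hne, ne_of_lt⟩

theorem rank_mul_eq_left_of_rank_eq {m p q : ℕ} (B : Matrix (Fin m) (Fin p) K)
    (C : Matrix (Fin p) (Fin q) K) (hC : C.rank = p) : (B * C).rank = B.rank := by
  have hC' : LinearMap.range C.mulVecLin = ⊤ :=
    Submodule.eq_top_of_finrank_eq (by rw [Module.finrank_fin_fun]; exact hC)
  rw [Matrix.rank, Matrix.rank, Matrix.mulVecLin_mul, LinearMap.range_comp, hC', Submodule.map_top]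

theorem rank_mul_eq_right_of_rank_eq {m p q : ℕ} (B : Matrix (Fin m) (Fin p) K)
    (C : Matrix (Fin p) (Fin q) K) (hB : B.rank = p) : (B * C).rank = C.rank := by
  rw [← Matrix.rank_transpose, Matrix.transpose_mul, rank_mul_eq_left_of_rank_eq _ _
    (by rw [Matrix.rank_transpose, hB]), Matrix.rank_transpose]

/-- A rank condition that fails on an interval of minimal length fails on a pair in `J(d)`. -/
theorem exists_mem_setJ {A : Rep K d} {i j : Fin (n + 1)} (hij : i < j)
    (hA : A ∈ rankLocus K d (i, j)) : ∃ q ∈ setJ d, A ∈ rankLocus K d q := by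
  induction hN : (j : ℕ) - i using Nat.strong_induction_on generalizing i j with
  | _ N ih =>
  subst hN
  by_cases hJ : (i, j) ∈ setJ d
  · exact ⟨_, hJ, hA⟩
  by_cases hshort : ∃ s t : Fin (n + 1), s < t ∧ (t : ℕ) - s < j - i ∧ A ∈ rankLocus K d (s, t)
  · obtain ⟨s, t, hst, hlt, hst'⟩ := hshort
    exact ih _ hlt hst hst' rfl
  push Not at hshort
  exfalso
  have hfull : ∀ s t : Fin (n + 1), s < t → (t : ℕ) - s < j - i → (A.comp s t).rank = minRank d s t :=
    fun s t hst hlt => le_antisymm (A.rank_comp_le hst.le) (not_lt.1 (hshort s t hst hlt))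
  have hrank : (A.comp i j).rank < minRank d i j := hA
  have hex : ∃ l, (i < l ∧ l < j) ∧ d l ≤ max (d i) (d j) := by
    by_contra! h
    exact hJ ⟨hij, fun l hil hlj => h l ⟨hil, hlj⟩⟩
  -- an inner vertex of minimal dimension
  obtain ⟨l, ⟨⟨hil, hlj⟩, hl⟩, hmin⟩ := Set.exists_min_image
    {l | (i < l ∧ l < j) ∧ d l ≤ max (d i) (d j)} d (Set.toFinite _) hex
  have hin : ∀ m, i < m → m < j → d l ≤ d m := fun m him hmj => by
    by_contra! h
    exact h.not_ge (hmin m ⟨⟨him, hmj⟩, h.le.trans hl⟩)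
  have h1 := hfull i l hil (by have := Fin.lt_def.1 hil; have := Fin.lt_def.1 hlj; omega)
  have h2 := hfull l j hlj (by have := Fin.lt_def.1 hil; have := Fin.lt_def.1 hlj; omega)
  rw [A.comp_mul hil.le hlj.le] at hrank
  rcases le_max_iff.1 hl with h | h
  · have h3 : minRank d i l = d l := by
      refine le_antisymm (minRank_le hil.le le_rfl) ((le_minRank_iff hil.le).2 fun m him hml => ?_)
      rcases eq_or_lt_of_le him with rfl | him
      · exact h
      · exact hin m him (hml.trans_lt hlj)
    rw [rank_mul_eq_right_of_rank_eq _ _ (h1.trans h3), h2] at hrank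
    exact hrank.not_ge ((le_minRank_iff hlj.le).2 fun m hlm hmj => minRank_le (hil.le.trans hlm) hmj)
  · have h3 : minRank d l j = d l := by
      refine le_antisymm (minRank_le le_rfl hlj.le) ((le_minRank_iff hlj.le).2 fun m hlm hmj => ?_)
      rcases eq_or_lt_of_le hmj with rfl | hmj
      · exact h
      · exact hin m (hil.trans_le hlm) hmj
    rw [rank_mul_eq_left_of_rank_eq _ _ (h2.trans h3), h1] at hrank
    exact hrank.not_ge ((le_minRank_iff hil.le).2 fun m him hml => minRank_le him (hml.trans hlj.le))

theorem minRank_of_mem_setJ_of_ge {i j : Fin (n + 1)} (hJ : (i, j) ∈ setJ d) (h : d j ≤ d i) :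
    minRank d i j = d j := by
  have := minRank_of_mem_setJ (mem_setJ_dual hJ) (by simpa only [Fin.rev_rev] using h)
  simpa only [minRank_dual, Fin.rev_rev] using this

/-- A pair in `J(d)` that is not in `I(d)` can be replaced by a longer one with a smaller difference
of dimensions. -/
theorem exists_mem_setI {A : Rep K d} {p : Fin (n + 1) × Fin (n + 1)} (hp : p ∈ setJ d)
    (hA : A ∈ rankLocus K d p) : ∃ q ∈ setI d, A ∈ rankLocus K d q := by
  obtain ⟨i, j⟩ := p
  induction hN : ((d j : ℤ) - d i).natAbs using Nat.strong_induction_on generalizing i j with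
  | _ N ih =>
  subst hN
  by_cases hI : (i, j) ∈ setI d
  · exact ⟨_, hI, hA⟩
  have hij : i < j := hp.1
  have hrank : (A.comp i j).rank < minRank d i j := hA
  rcases lt_trichotomy (d i) (d j) with h | h | h
  · have hex : ∃ l, (j < l ∧ ∀ m, j < m → m ≤ l → d i ≤ d m) ∧ d l < d j := by
      by_contra! hno
      exact hI ⟨hp, Or.inr (Or.inl ⟨h, fun l hl hm => hno l ⟨hl, hm⟩⟩)⟩
    obtain ⟨l, ⟨⟨hjl, hm⟩, hlj⟩, hfirst⟩ := Set.exists_min_image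
      {l | (j < l ∧ ∀ m, j < m → m ≤ l → d i ≤ d m) ∧ d l < d j} id (Set.toFinite _) hex
    have hJ : (i, l) ∈ setJ d := by
      refine ⟨hij.trans hjl, fun m him hml => max_lt ?_ ?_⟩
      all_goals
        have hdil : d i ≤ d l := hm l hjl le_rfl
        have hdm : d l < d m := by
          rcases lt_or_ge m j with hmj | hmj
          · exact hlj.trans ((le_max_right _ _).trans_lt (hp.2 m him hmj))
          · rcases eq_or_lt_of_le hmj with rfl | hmj
            · exact hlj
            · have : ¬ d m < d j := fun hlt => (hfirst m ⟨⟨hmj, fun m' h1 h2 =>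
                hm m' h1 (h2.trans hml.le)⟩, hlt⟩).not_gt hml
              exact hlj.trans_le (not_lt.1 this)
        first
          | exact hdm
          | exact hdil.trans_lt hdm
    have hdil : d i ≤ d l := hm l hjl le_rfl
    refine ih _ ?_ i l hJ ?_ rfl
    · omega
    · change (A.comp i l).rank < minRank d i l
      rw [minRank_of_mem_setJ hJ hdil]
      rw [minRank_of_mem_setJ hp h.le] at hrank
      rw [A.comp_mul hij.le hjl.le]
      exact (Matrix.rank_mul_le_left _ _).trans_lt hrank
  · exact absurd ⟨hp, Or.inl h⟩ hI
  · have hex : ∃ l, (l < i ∧ ∀ m, l ≤ m → m < i → d j ≤ d m) ∧ d l < d i := by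
      by_contra! hno
      exact hI ⟨hp, Or.inr (Or.inr ⟨h, fun l hl hm => hno l ⟨hl, hm⟩⟩)⟩
    obtain ⟨l, ⟨⟨hli, hm⟩, hlt⟩, hlast⟩ := Set.exists_max_image
      {l | (l < i ∧ ∀ m, l ≤ m → m < i → d j ≤ d m) ∧ d l < d i} id (Set.toFinite _) hex
    have hdjl : d j ≤ d l := hm l le_rfl hli
    have hJ : (l, j) ∈ setJ d := by
      refine ⟨hli.trans hij, fun m hlm hmj => ?_⟩
      have hdm : d l < d m := by
        rcases lt_or_ge i m with him | him
        · exact hlt.trans ((le_max_left _ _).trans_lt (hp.2 m him hmj))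
        · rcases eq_or_lt_of_le him with rfl | him
          · exact hlt
          · have : ¬ d m < d i := fun hlt' => (hlast m ⟨⟨him, fun m' h1 h2 =>
              hm m' (hlm.le.trans h1) h2⟩, hlt'⟩).not_gt hlm
            exact hlt.trans_le (not_lt.1 this)
      exact max_lt hdm (hdjl.trans_lt hdm)
    refine ih _ ?_ l j hJ ?_ rfl
    · omega
    · change (A.comp l j).rank < minRank d l j
      rw [minRank_of_mem_setJ_of_ge hJ hdjl]
      rw [minRank_of_mem_setJ_of_ge hp h.le] at hrank
      rw [A.comp_mul hli.le hij.le]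
      exact (Matrix.rank_mul_le_right _ _).trans_lt hrank

theorem complY_eq_iUnion : complY K d = ⋃ p ∈ setI d, rankLocus K d p := by
  ext A
  simp only [Set.mem_iUnion, exists_prop]
  constructor
  · intro hA
    obtain ⟨i, j, hij, h⟩ := mem_complY_iff.1 hA
    obtain ⟨q, hq, hq'⟩ := exists_mem_setJ hij h
    exact exists_mem_setI hq hq'
  · rintro ⟨p, hp, hA⟩
    exact mem_complY_iff.2 ⟨p.1, p.2, hp.1.1, hA⟩

theorem rankLocus_subset_complY {p : Fin (n + 1) × Fin (n + 1)} (hp : p.1 < p.2) :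
    rankLocus K d p ⊆ complY K d := fun _ hA => mem_complY_iff.2 ⟨p.1, p.2, hp, hA⟩

theorem exists_subset_rankLocus {Z : Set (Rep K d)} (hZ : IsIrreducible Z) (hZY : Z ⊆ complY K d) :
    ∃ p ∈ setI d, Z ⊆ rankLocus K d p := by
  classical
  obtain ⟨_, hT, hZT⟩ := isIrreducible_iff_sUnion_isClosed.1 hZ
    ((Set.toFinite (setI d)).toFinset.image (rankLocus K d)) (by
      intro T hT
      obtain ⟨p, hp, rfl⟩ := Finset.mem_image.1 hT
      exact isClosed_rankLocus ((Set.Finite.mem_toFinset _).1 hp).1.1.le) (by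
      intro A hA
      obtain ⟨p, hp, hAp⟩ := Set.mem_iUnion₂.1 (complY_eq_iUnion (K := K) (d := d) ▸ hZY hA)
      exact ⟨_, Finset.mem_coe.2 (Finset.mem_image.2 ⟨p, (Set.Finite.mem_toFinset _).2 hp, rfl⟩),
        hAp⟩)
  obtain ⟨p, hp, rfl⟩ := Finset.mem_image.1 hT
  exact ⟨p, (Set.Finite.mem_toFinset _).1 hp, hZT⟩

/-! ### Dense orbits -/

theorem glOrbit_subset_rankLocus {A : Rep K d} {p : Fin (n + 1) × Fin (n + 1)} (hp : p.1 ≤ p.2)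
    (hA : A ∈ rankLocus K d p) : glOrbit A ⊆ rankLocus K d p := by
  rintro _ ⟨g, rfl⟩
  rw [rankLocus, Set.mem_ofPred_eq, Rep.rank_comp_glAct g A hp]
  exact hA

theorem glOrbit_symm {A B : Rep K d} (h : B ∈ glOrbit A) : A ∈ glOrbit B := by
  obtain ⟨g, rfl⟩ := h
  exact mem_glOrbit_of_rank_eq fun i j hij => Rep.rank_comp_glAct g A hij

theorem glOrbit_trans {A B C : Rep K d} (h : B ∈ glOrbit A) (h' : C ∈ glOrbit B) :
    C ∈ glOrbit A := by
  obtain ⟨g, rfl⟩ := h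
  obtain ⟨g', rfl⟩ := h'
  exact mem_glOrbit_of_rank_eq fun i j hij => by
    rw [Rep.rank_comp_glAct g' _ hij, Rep.rank_comp_glAct g A hij]

/-- An irreducible set has a representation for which the ranks of all composite maps are as large
as possible on the set; the representations in the set with these ranks form an open subset. -/
theorem exists_max_rank {Z : Set (Rep K d)} (hZ : IsIrreducible Z) :
    ∃ A ∈ Z, ∃ U : Set (Rep K d), IsOpen U ∧ A ∈ U ∧
      ∀ B ∈ Z ∩ U, ∀ i j, i ≤ j → (A.comp i j).rank = (B.comp i j).rank := by
  classical
  have hmax : ∀ q : Fin (n + 1) × Fin (n + 1), ∃ A ∈ Z, ∀ B ∈ Z,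
      (B.comp q.1 q.2).rank ≤ (A.comp q.1 q.2).rank := by
    intro q
    have hne : ((fun B : Rep K d => (B.comp q.1 q.2).rank) '' Z).Nonempty := hZ.nonempty.image _
    have hbdd : BddAbove ((fun B : Rep K d => (B.comp q.1 q.2).rank) '' Z) :=
      ⟨d q.2, by rintro _ ⟨B, _, rfl⟩; exact Matrix.rank_le_width _⟩
    obtain ⟨A, hA, hA'⟩ := Nat.sSup_mem hne hbdd
    exact ⟨A, hA, fun B hB => (le_csSup hbdd ⟨B, hB, rfl⟩).trans hA'.ge⟩
  choose M hMZ hM using hmax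
  let V : Fin (n + 1) × Fin (n + 1) → Set (Rep K d) := fun q =>
    {B | q.1 ≤ q.2 → ((M q).comp q.1 q.2).rank ≤ (B.comp q.1 q.2).rank}
  have hVopen : ∀ q, IsOpen (V q) := by
    intro q
    by_cases h : q.1 ≤ q.2
    · simpa only [V, h, true_imp_iff] using isOpen_le_rank h _
    · simp only [V, h, false_imp_iff, Set.ofPred_true, isOpen_univ]
  obtain ⟨A, hAZ, hAU⟩ := isIrreducible_iff_sInter.1 hZ (Finset.univ.image V)
    (Finset.forall_mem_image.2 fun q _ => hVopen q)
    (Finset.forall_mem_image.2 fun q _ => ⟨M q, hMZ q, fun _ => le_rfl⟩)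
  have hAV : ∀ q, A ∈ V q := fun q => hAU (V q) (by simp)
  refine ⟨A, hAZ, ⋂ q, V q, isOpen_iInter_of_finite hVopen, Set.mem_iInter.2 hAV, ?_⟩
  rintro B ⟨hBZ, hBV⟩ i j hij
  exact le_antisymm ((hM (i, j) A hAZ).trans (Set.mem_iInter.1 hBV (i, j) hij))
    ((hM (i, j) B hBZ).trans (hAV (i, j) hij))

/-- An irreducible rank locus is the closure of an orbit, which is unique since it is open in the
locus. -/
theorem exists_denseOrbitIn {p : Fin (n + 1) × Fin (n + 1)} (hp : p.1 ≤ p.2)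
    (hZ : IsIrreducible (rankLocus K d p)) :
    ∃ M : Rep K d, DenseOrbitIn M (rankLocus K d p) ∧
      ∀ M', DenseOrbitIn M' (rankLocus K d p) → M' ∈ glOrbit M := by
  obtain ⟨M, hM, U, hU, hMU, hrank⟩ := exists_max_rank hZ
  have hsub : rankLocus K d p ∩ U ⊆ glOrbit M := fun B hB => mem_glOrbit_of_rank_eq (hrank B hB)
  refine ⟨M, ⟨glOrbit_subset_rankLocus hp hM, ?_⟩, fun M' hM' => ?_⟩
  · exact (subset_closure_inter_of_isPreirreducible_of_isOpen hZ.2 hU ⟨M, hM, hMU⟩).trans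
      (closure_mono hsub)
  · obtain ⟨B, hBU, hBM'⟩ := mem_closure_iff.1 (hM'.2 hM) U hU hMU
    exact glOrbit_trans (hsub ⟨hM'.1 hBM', hBU⟩) (glOrbit_symm hBM')

/-! ### The generic orbit -/

theorem stdRep_mem_genericOrbit : stdRep K d ∈ genericOrbit K d := fun _ _ hij =>
  le_antisymm (Rep.rank_comp_le _ hij.le)
    (le_rank_of_mulVec_evec _ (minRank_le hij.le le_rfl) id
      (fun _ hb => hb.trans_le (minRank_le le_rfl hij.le)) (fun _ _ _ _ h => h)
      fun _ hb => stdRep_comp_mulVec_evec hij.le hb)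

theorem rank_comp_of_mem_genericOrbit {A : Rep K d} (hA : A ∈ genericOrbit K d)
    {i j : Fin (n + 1)} (hij : i ≤ j) : (A.comp i j).rank = minRank d i j := by
  rcases eq_or_lt_of_le hij with rfl | hij
  · rw [Rep.comp_self, Matrix.rank_one, Fintype.card_fin, minRank, Set.Icc_self, Set.image_singleton,
      csInf_singleton]
  · exact hA i j hij

theorem genericOrbit_eq_glOrbit : genericOrbit K d = glOrbit (stdRep K d) := by
  ext A
  constructor
  · exact fun hA => mem_glOrbit_of_rank_eq fun i j hij => by
      rw [rank_comp_of_mem_genericOrbit hA hij,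
        rank_comp_of_mem_genericOrbit stdRep_mem_genericOrbit hij]
  · rintro ⟨g, rfl⟩ i j hij
    rw [Rep.rank_comp_glAct g _ hij.le]
    exact stdRep_mem_genericOrbit i j hij

theorem isOpen_genericOrbit : IsOpen (genericOrbit K d) := by
  have : IsClosed (complY K d) := by
    rw [complY_eq_iUnion]
    exact (Set.toFinite _).isClosed_biUnion fun p hp => isClosed_rankLocus hp.1.1.le
  simpa [complY] using this.isOpen_compl

section Infinite

variable [Infinite K]

theorem dense_genericOrbit : Dense (genericOrbit K d) := by
  have h := subset_closure_inter_of_isPreirreducible_of_isOpen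
    (isPreirreducible_univ (K := K) (d := d)) isOpen_genericOrbit
    ⟨stdRep K d, Set.mem_univ _, stdRep_mem_genericOrbit⟩
  rw [Set.univ_inter] at h
  exact fun A => h (Set.mem_univ A)

/-! ### The irreducible components -/

theorem rankLocus_mem_components (hd : ∀ i, 0 < d i) {p : Fin (n + 1) × Fin (n + 1)}
    (hp : p ∈ setI d) : rankLocus K d p ∈ components (complY K d) := by
  refine ⟨⟨isIrreducible_rankLocus hd hp.1, rankLocus_subset_complY hp.1.1⟩, ?_⟩
  rintro W ⟨hW, hWY⟩ hle
  obtain ⟨q, hq, hWq⟩ := exists_subset_rankLocus hW hWY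
  obtain ⟨A, hA, hA'⟩ := exists_mem_rankLocus (K := K) hd hp
  rwa [hA' q hq.1 (hWq (hle hA))] at hWq

theorem bijOn_components (hd : ∀ i, 0 < d i) :
    Set.BijOn (rankLocus K d) (setI d) (components (complY K d)) := by
  refine ⟨fun p hp => rankLocus_mem_components hd hp, fun p hp q hq hpq => ?_, fun Z hZ => ?_⟩
  · obtain ⟨A, hA, hA'⟩ := exists_mem_rankLocus (K := K) hd hp
    have h : rankLocus K d p = rankLocus K d q := hpq
    exact (hA' q hq.1 (h ▸ hA)).symm
  · obtain ⟨p, hp, hZp⟩ := exists_subset_rankLocus hZ.1.1 hZ.1.2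
    exact ⟨p, hp, (hZ.2 (rankLocus_mem_components hd hp).1 hZp).antisymm hZp⟩

theorem codim_rankLocus_eq_one_iff (hd : ∀ i, 0 < d i) {p : Fin (n + 1) × Fin (n + 1)}
    (hp : p ∈ setJ d) : codim (rankLocus K d p) = 1 ↔ d p.1 = d p.2 := by
  rw [codim_rankLocus (i := p.1) (j := p.2) hd hp, Nat.cast_eq_one]
  omega

end Infinite

end QuiverA

theorem theorem1p1 {K : Type*} [Field K] [Infinite K] {n : ℕ} (d : Fin (n + 1) → ℕ)
    (hd : ∀ i, 0 < d i) :
    -- the generic orbit is an orbit, and it is open and dense in the representation space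
    ((∃ A : QuiverA.Rep K d, QuiverA.genericOrbit K d = QuiverA.glOrbit A) ∧
      IsOpen (QuiverA.genericOrbit K d) ∧ Dense (QuiverA.genericOrbit K d)) ∧
    -- (i) the decomposition of the complement into pairwise different irreducible components
    (QuiverA.complY K d = (⋃ p ∈ QuiverA.setI d, QuiverA.rankLocus K d p) ∧
      Set.BijOn (QuiverA.rankLocus K d) (QuiverA.setI d)
        (QuiverA.components (QuiverA.complY K d))) ∧
    -- (ii) for `p` in `J(d)` there is `M(p)`, unique up to isomorphism, with orbit dense in `Y_p`;
    -- the components are the closures of the orbits of the `M(p)`, `p` in `I(d)`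
    (∃ M : Fin (n + 1) × Fin (n + 1) → QuiverA.Rep K d,
      (∀ p ∈ QuiverA.setJ d, QuiverA.DenseOrbitIn (M p) (QuiverA.rankLocus K d p) ∧
        ∀ M', QuiverA.DenseOrbitIn M' (QuiverA.rankLocus K d p) → M' ∈ QuiverA.glOrbit (M p)) ∧
      ∀ p ∈ QuiverA.setI d, QuiverA.AlmostGeneric (M p) ∧
        QuiverA.rankLocus K d p = closure (QuiverA.glOrbit (M p))) ∧
    -- (iii) codimensions
    (∀ p ∈ QuiverA.setJ d, IsClosed (QuiverA.rankLocus K d p) ∧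
      IsIrreducible (QuiverA.rankLocus K d p) ∧
      QuiverA.codim (QuiverA.rankLocus K d p) =
        (((d p.2 : ℤ) - (d p.1 : ℤ)).natAbs + 1 : ℕ)) ∧
    -- (iv) the components of codimension one
    Set.BijOn (QuiverA.rankLocus K d)
      {p | p.1 < p.2 ∧ d p.1 = d p.2 ∧ ∀ l, p.1 < l → l < p.2 → d p.1 < d l}
      {Z | Z ∈ QuiverA.components (QuiverA.complY K d) ∧ QuiverA.codim Z = 1} := by
  have hclosed : ∀ p ∈ QuiverA.setJ d, IsClosed (QuiverA.rankLocus K d p) := fun p hp =>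
    QuiverA.isClosed_rankLocus hp.1.le
  have hM : ∀ p : Fin (n + 1) × Fin (n + 1), ∃ M : QuiverA.Rep K d, p ∈ QuiverA.setJ d →
      QuiverA.DenseOrbitIn M (QuiverA.rankLocus K d p) ∧
        ∀ M', QuiverA.DenseOrbitIn M' (QuiverA.rankLocus K d p) → M' ∈ QuiverA.glOrbit M := by
    intro p
    by_cases hp : p ∈ QuiverA.setJ d
    · obtain ⟨M, hM⟩ := QuiverA.exists_denseOrbitIn hp.1.le
        (QuiverA.isIrreducible_rankLocus (K := K) hd hp)
      exact ⟨M, fun _ => hM⟩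
    · exact ⟨QuiverA.stdRep K d, fun h => absurd h hp⟩
  choose M hM using hM
  refine ⟨⟨⟨_, QuiverA.genericOrbit_eq_glOrbit⟩, QuiverA.isOpen_genericOrbit,
    QuiverA.dense_genericOrbit⟩, ⟨QuiverA.complY_eq_iUnion, QuiverA.bijOn_components hd⟩,
    ⟨M, hM, fun p hp => ⟨⟨_, QuiverA.rankLocus_mem_components hd hp, (hM p hp.1).1⟩, ?_⟩⟩,
    fun p hp => ⟨hclosed p hp, QuiverA.isIrreducible_rankLocus hd hp,
      QuiverA.codim_rankLocus hd hp⟩, ?_⟩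
  · exact (hM p hp.1).1.2.antisymm (closure_minimal (hM p hp.1).1.1 (hclosed p hp.1))
  · have hI : ∀ p, (p.1 < p.2 ∧ d p.1 = d p.2 ∧ ∀ l, p.1 < l → l < p.2 → d p.1 < d l) ↔
        p ∈ QuiverA.setI d ∧ d p.1 = d p.2 := by
      intro p
      constructor
      · rintro ⟨h1, h2, h3⟩
        exact ⟨⟨⟨h1, fun l hl hl' => max_lt (h3 l hl hl') (h2 ▸ h3 l hl hl')⟩, Or.inl h2⟩, h2⟩
      · rintro ⟨h1, h2⟩
        exact ⟨h1.1.1, h2, fun l hl hl' => (le_max_left _ _).trans_lt (h1.1.2 l hl hl')⟩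
    obtain ⟨hmaps, hinj, hsurj⟩ := QuiverA.bijOn_components (K := K) hd
    refine ⟨fun p hp => ?_, fun p hp q hq h => hinj ((hI p).1 hp).1 ((hI q).1 hq).1 h, ?_⟩
    · obtain ⟨h1, h2⟩ := (hI p).1 hp
      exact ⟨hmaps h1, (QuiverA.codim_rankLocus_eq_one_iff hd h1.1).2 h2⟩
    · rintro Z ⟨hZ, hcodim⟩
      obtain ⟨p, hp, rfl⟩ := hsurj hZ
      exact ⟨p, (hI p).2 ⟨hp, (QuiverA.codim_rankLocus_eq_one_iff hd hp.1).1 hcodim⟩, rfl⟩
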